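/- For $k\ge 1$, a \emph{$k$-chain} is a continuous curve in the Euclidean plane made up of $k$ consecutive straight pieces (arms), of which the first and the last are infinite and the others are non-degenerate finite segments: for $k=1$ it is a line, and for $k\ge 2$ it starts and ends with a ray. A \emph{self-crossing} of a chain is a point at which the relative interiors of two of its arms cross (meet in exactly that point). An \emph{intersection} of two chains is a point which is the only common point of some arm of the first and some arm of the second. The \emph{regions} formed by a finite family of chains are the connected components of the complement of their union. Let $k\ge 1$ and $n\ge 0$ be integers. Then: (1) the maximum number of self-crossings of a single $k$-chain is $\binom{k-1}{2}$; (2) the maximum number of intersections of two $k$-chains is $k^2$; (3) the maximum number of regions formed by $n$ $k$-chains (in any position) is $$a_{k\mathsf C}(n)=\frac{k^2n^2}{2}-\frac{3kn}{2}+2n+1 .$$ (4) This maximum is attained by substituting narrow self-intersecting chains into a pancake graph if $k$ is odd, and into a hatpin graph if $k$ is even. Precisely: if $k$ is odd, there are $n$ lines $\ell_1,\dots,\ell_n$, any two of which meet in exactly one point and no three of which are concurrent, such that for every $\varepsilon>0$ there are $k$-chains $C_1,\dots,C_n$ forming exactly $a_{k\mathsf C}(n)$ regions, for which $\operatorname{dist}(x,\ell_i)\le\varepsilon(1+\|x\|)$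 for all $i$ and all $x\in C_i$, the two infinite arms of each $C_i$ point to infinity in opposite directions (their directions make an obtuse angle), each $C_i$ has $\binom{k-1}{2}$ self-crossings, and any two of the $C_i$ have $k^2$ intersections. If $k$ is even, the same holds with rays $\ell_1,\dots,\ell_n$ (any two of which meet in exactly one point, no endpoint of one lying on another, and no three concurrent) in place of the lines, and with the two infinite arms of each $C_i$ pointing in the same direction (their directions make an acute angle). -/

import Mathlib

noncomputable section

/-- The Euclidean plane. -/
abbrev Plane : Type := EuclideanSpace ℝ (Fin 2)

/-- A `k`-chain (`k ≥ 1`), that is a continuous plane curve made up of `k` straight pieces, of which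
the first and the last are infinite and the others finite.  The bends (base nodes) are
`pt 1, …, pt (k - 1)`; the auxiliary points `pt 0` and `pt k` only fix the directions of the two
infinite pieces.  For `k = 1` this is the line through `pt 0` and `pt 1`. -/
structure Chain (k : ℕ) where
  pt : Fin (k + 1) → Plane
  ne : ∀ i : Fin k, pt i.castSucc ≠ pt i.succ

namespace Chain

variable {k : ℕ}

/-- The `i`-th arm, a subset of the line through `pt i` and `pt (i + 1)`.  It ends at `pt i` unless
it is the first arm, and at `pt (i + 1)` unless it is the last one.  So an arm is a segment, or a
ray if it is the first or the last of at least two arms, or the whole line if it is the only arm. -/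
def arm (C : Chain k) (i : Fin k) : Set Plane :=
  AffineMap.lineMap (C.pt i.castSucc) (C.pt i.succ) ''
    {s : ℝ | (0 < (i : ℕ) → 0 ≤ s) ∧ ((i : ℕ) + 1 < k → s ≤ 1)}

/-- The `i`-th arm without its endpoints. -/
def openArm (C : Chain k) (i : Fin k) : Set Plane :=
  AffineMap.lineMap (C.pt i.castSucc) (C.pt i.succ) ''
    {s : ℝ | (0 < (i : ℕ) → 0 < s) ∧ ((i : ℕ) + 1 < k → s < 1)}

/-- The point set of the chain. -/
def carrier (C : Chain k) : Set Plane := ⋃ i, C.arm i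

/-- The self-crossings of a chain: the points at which two of its arms cross.  (The relative
interiors of two arms meet in exactly one point if and only if the two arms cross there
transversally; arms that overlap or that only touch at an endpoint contribute nothing.) -/
def selfCrossings (C : Chain k) : Set Plane :=
  {p | ∃ i j : Fin k, i ≠ j ∧ C.openArm i ∩ C.openArm j = {p}}

/-- The intersections of two chains: the points that are the only common point of an arm of the
first and an arm of the second.  If the point sets of the chains have a finite intersection, then
this is that intersection. -/
def intersections (C D : Chain k) : Set Plane :=
  {p | ∃ i j : Fin k, C.arm i ∩ D.arm j = {p}}

/-- The direction vector of the `i`-th arm, as the chain is traversed from start to end. -/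
def dir (C : Chain k) (i : Fin k) : Plane := C.pt i.succ - C.pt i.castSucc

/-- The two infinite arms point to infinity in opposite directions (they make an obtuse angle).
The first arm leaves to infinity in direction `- C.dir 0`, the last one in direction
`C.dir (k - 1)`. -/
def EndsOpposite (C : Chain k) : Prop :=
  ∀ i j : Fin k, (i : ℕ) = 0 → (j : ℕ) + 1 = k → inner ℝ (-C.dir i) (C.dir j) < 0

/-- The two infinite arms point to infinity in the same direction (they make an acute angle). -/
def EndsParallel (C : Chain k) : Prop :=
  ∀ i j : Fin k, (i : ℕ) = 0 → (j : ℕ) + 1 = k → 0 < inner ℝ (-C.dir i) (C.dir j)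

/-- The chain is narrow around the line or ray `ℓ`: it lies in an `ε`-thin (double) wedge
around `ℓ`. -/
def NarrowAround (C : Chain k) (ε : ℝ) (ℓ : Set Plane) : Prop :=
  ∀ x ∈ C.carrier, Metric.infDist x ℓ ≤ ε * (1 + ‖x‖)

end Chain

/-- The regions into which the set `S` divides the plane: the connected components of the
complement of `S`. -/
def planeRegions (S : Set Plane) : Set (Set Plane) :=
  {R | ∃ x ∈ Sᶜ, R = connectedComponentIn Sᶜ x}

/-- The number of regions formed by drawing the chains `C 0, …, C (n - 1)`. -/
def chainRegionCount {k n : ℕ} (C : Fin n → Chain k) : ℕ∞ :=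
  (planeRegions (⋃ i, (C i).carrier)).encard

/-- `L` is an (optimal) pancake graph: lines `{P i + t • v i | t ∈ ℝ}`, any two of which
meet in exactly one point, and no three of which have a common point. -/
def IsPancakeGraph {n : ℕ} (L : Fin n → Set Plane) : Prop :=
  (∃ P v : Fin n → Plane, ∀ i, v i ≠ 0 ∧ L i = {x | ∃ t : ℝ, x = P i + t • v i}) ∧
  (∀ i j, i ≠ j → ∃ p, L i ∩ L j = {p}) ∧
  (∀ i j l, i ≠ j → i ≠ l → j ≠ l → L i ∩ L j ∩ L l = ∅)

/-- `L` is an (optimal) hatpin graph: rays `{P i + t • v i | t ≥ 0}`, any two of which meet in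
exactly one point, no head `P i` lying on another ray, and no three having a common point. -/
def IsHatpinGraph {n : ℕ} (L : Fin n → Set Plane) : Prop :=
  (∃ P v : Fin n → Plane, (∀ i, v i ≠ 0 ∧ L i = {x | ∃ t : ℝ, 0 ≤ t ∧ x = P i + t • v i}) ∧
    ∀ i j, i ≠ j → P i ∉ L j) ∧
  (∀ i j, i ≠ j → ∃ p, L i ∩ L j = {p}) ∧
  (∀ i j l, i ≠ j → i ≠ l → j ≠ l → L i ∩ L j ∩ L l = ∅)

end

noncomputable section

open Set Filter Topology

/-! The number of regions is the dimension of `locConst S`, where `S` is the union of the chains.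
Indicators of regions are independent elements (`encard_planeRegions_le`), and an element is
determined by one value per region (`card_le_encard_planeRegions`). Both bounds on regions thus
become linear algebra.

Upper bound: draw the arms one at a time. A function that is locally constant off the old set and
the new arm comes from the old space if it does not jump across the line of the arm. Its jump is
constant along each component of that line minus the old set, and is zero on components that stick
out of the arm. The `m` earlier arms are convex, so there are at most `m + 1` components, and each
end of the new arm costs one (`Chain.rank_locConst_union_arm_le`). With `n * k` arms and `2 * (k -
1)` ends per chain, the sum 1 + nk(nk+1)/2 - 2n(k-1) is the formula.

Lower bound: a polygonal path from infinity to infinity is seen from a point off it under a total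
angle that is continuous and constant modulo 2π, hence locally constant; it jumps by ±2π across a
simple point of the path. Every crossing of two arms gives such a path, which switches from one arm
to the other there; every chain gives one more, and there are the constants. For chains in general
position these functions are independent (`InGeneralPosition.linearIndependent_pathAngle`): at a
crossing, only the path that switches there has a jump that changes along the first arm. If all
possible pairs of arms cross, their number is `maxRegions k n`.

Extremal chains zigzag between the lines x = 0 and x = 1. The line of an arm is encoded by its
heights (l, r) over these abscissas: arms cross if l and r are ordered oppositely, and concurrent
lines give collinear points. The chains put a small multiple δ of one model chain on top of lines in
general position; all conditions hold for small δ (`eventually_narrowChain`). The bounds on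
crossings and intersections come from one point per pair of arms, adjacent arms of a chain being
excluded, and the same family attains them. -/

theorem eq_of_isPreconnected_of_eventually_eq {X Y : Type*} [TopologicalSpace X] {U : Set X}
    (hU : IsPreconnected U) {f : X → Y} (h : ∀ x ∈ U, ∀ᶠ y in 𝓝[U] x, f y = f x)
    {x y : X} (hx : x ∈ U) (hy : y ∈ U) : f x = f y :=
  hU.induction₂ (fun a b => f a = f b) (fun a ha => (h a ha).mono fun _ hb => hb.symm)
    (fun _ _ _ _ _ _ h₁ h₂ => h₁.trans h₂) (fun _ _ _ _ h₁ => h₁.symm) hx hy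

/-! ### Locally constant functions and the number of regions -/

/-- The functions that vanish on `S` and are locally constant off `S`. -/
def locConst (S : Set Plane) : Submodule ℝ (Plane → ℝ) where
  carrier := {f | (∀ x ∈ S, f x = 0) ∧ ∀ x ∉ S, ∀ᶠ y in 𝓝 x, f y = f x}
  add_mem' := by
    rintro f g ⟨hf, hf'⟩ ⟨hg, hg'⟩
    refine ⟨fun x hx => by simp [hf x hx, hg x hx], fun x hx => ?_⟩
    filter_upwards [hf' x hx, hg' x hx] with y h₁ h₂
    simp [h₁, h₂]
  zero_mem' := ⟨fun _ _ => rfl, fun _ _ => Eventually.of_forall fun _ => rfl⟩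
  smul_mem' := by
    rintro c f ⟨hf, hf'⟩
    refine ⟨fun x hx => by simp [hf x hx], fun x hx => ?_⟩
    filter_upwards [hf' x hx] with y h₁
    simp [h₁]

theorem eq_of_mem_locConst {S U : Set Plane} {f : Plane → ℝ} (hf : f ∈ locConst S)
    (hU : IsPreconnected U) (hUS : U ⊆ Sᶜ) {x y : Plane} (hx : x ∈ U) (hy : y ∈ U) : f x = f y :=
  eq_of_isPreconnected_of_eventually_eq hU
    (fun z hz => (hf.2 z (hUS hz)).filter_mono nhdsWithin_le_nhds) hx hy

theorem locConst_empty_rank : Module.rank ℝ (locConst ∅) ≤ 1 := by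
  have h : locConst ∅ ≤ Submodule.span ℝ {(fun _ => 1 : Plane → ℝ)} := by
    intro f hf
    rw [Submodule.mem_span_singleton]
    refine ⟨f 0, funext fun x => ?_⟩
    have := eq_of_mem_locConst hf (isPreconnected_univ) (by simp) (mem_univ 0) (mem_univ x)
    simpa using this
  exact (Submodule.rank_mono h).trans (rank_span_le _ |>.trans (by simp))

theorem planeRegions_eq_of_mem {S : Set Plane} {R : Set Plane} (hR : R ∈ planeRegions S)
    {x : Plane} (hx : x ∈ R) : x ∈ Sᶜ ∧ R = connectedComponentIn Sᶜ x := by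
  obtain ⟨y, hy, rfl⟩ := hR
  exact ⟨connectedComponentIn_subset _ _ hx, (connectedComponentIn_eq hx)⟩

theorem planeRegions_nonempty {S : Set Plane} {R : Set Plane} (hR : R ∈ planeRegions S) :
    R.Nonempty := by
  obtain ⟨y, hy, rfl⟩ := hR
  exact ⟨y, mem_connectedComponentIn hy⟩

theorem indicator_mem_locConst {S : Set Plane} (hS : IsClosed S) {R : Set Plane}
    (hR : R ∈ planeRegions S) : R.indicator (fun _ => (1 : ℝ)) ∈ locConst S := by
  refine ⟨fun x hx => ?_, fun x hx => ?_⟩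
  · refine indicator_of_notMem (fun h => ?_) _
    exact (planeRegions_eq_of_mem hR h).1 hx
  · have ho : IsOpen (connectedComponentIn Sᶜ x) := hS.isOpen_compl.connectedComponentIn
    filter_upwards [ho.mem_nhds (mem_connectedComponentIn hx)] with y hy
    have : y ∈ R ↔ x ∈ R := by
      have e := connectedComponentIn_eq hy
      constructor
      · intro h
        rw [(planeRegions_eq_of_mem hR h).2, ← e]
        exact mem_connectedComponentIn hx
      · intro h
        rw [(planeRegions_eq_of_mem hR h).2]
        exact hy
    by_cases h : x ∈ R
    · rw [indicator_of_mem h, indicator_of_mem (this.2 h)]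
    · rw [indicator_of_notMem h, indicator_of_notMem (fun h' => h (this.1 h'))]

/-- Indicators of distinct regions have disjoint nonempty supports, so they are linearly
independent. -/
theorem encard_planeRegions_le {S : Set Plane} (hS : IsClosed S) {N : ℕ}
    (h : Module.rank ℝ (locConst S) ≤ N) : (planeRegions S).encard ≤ N := by
  have hli : LinearIndependent ℝ (fun R : planeRegions S =>
      (⟨_, indicator_mem_locConst hS R.2⟩ : locConst S)) := by
    rw [linearIndependent_iff']
    intro t c hc R hR
    obtain ⟨x, hx⟩ := planeRegions_nonempty R.2
    have h0 := congrFun (congrArg Subtype.val hc) x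
    simp only [Submodule.coe_sum, Submodule.coe_smul, Finset.sum_apply, Pi.smul_apply,
      smul_eq_mul, Submodule.coe_zero, Pi.zero_apply] at h0
    rw [Finset.sum_eq_single R] at h0
    · simpa [indicator_of_mem hx] using h0
    · intro R' _ hne
      rw [indicator_of_notMem, mul_zero]
      intro hx'
      exact hne (Subtype.ext ((planeRegions_eq_of_mem R'.2 hx').2.trans
        (planeRegions_eq_of_mem R.2 hx).2.symm))
    · exact fun h => (h hR).elim
  have h1 := hli.cardinal_lift_le_rank
  have h2 : Cardinal.mk (planeRegions S) ≤ N := by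
    have := h1.trans (Cardinal.lift_le.2 h)
    simpa using this
  rw [← Set.toENat_cardinalMk]
  simpa using Cardinal.toENat.monotone' h2

/-- A function in `locConst S` is determined by its values at one point per region, so evaluation at
such points keeps the family independent. -/
theorem card_le_encard_planeRegions {S : Set Plane} {ι : Type*} [Fintype ι]
    {v : ι → Plane → ℝ} (hv : LinearIndependent ℝ v) (hm : ∀ i, v i ∈ locConst S) :
    (Fintype.card ι : ℕ∞) ≤ (planeRegions S).encard := by
  by_cases hfin : (planeRegions S).Finite
  swap
  · rw [Set.encard_eq_top_iff.2 hfin]; exact le_top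
  have := hfin.fintype
  choose p hp using fun R : planeRegions S => planeRegions_nonempty R.2
  let Φ : (Plane → ℝ) →ₗ[ℝ] (planeRegions S → ℝ) := LinearMap.funLeft ℝ ℝ p
  have hli : LinearIndependent ℝ (fun i => Φ (v i)) := by
    rw [Fintype.linearIndependent_iff] at hv ⊢
    intro c hc
    apply hv
    have hmem : (∑ i, c i • v i) ∈ locConst S :=
      Submodule.sum_mem _ fun i _ => Submodule.smul_mem _ _ (hm i)
    have hz : Φ (∑ i, c i • v i) = 0 := by simpa using hc
    funext x
    by_cases hx : x ∈ S
    · exact hmem.1 x hx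
    · have hR : connectedComponentIn Sᶜ x ∈ planeRegions S := ⟨x, hx, rfl⟩
      have h1 := eq_of_mem_locConst hmem (isPreconnected_connectedComponentIn)
        (connectedComponentIn_subset _ _) (mem_connectedComponentIn hx) (hp ⟨_, hR⟩)
      rw [h1]
      exact congrFun hz ⟨_, hR⟩
  have h1 := hli.fintype_card_le_finrank
  rw [Module.finrank_fintype_fun_eq_card] at h1
  rw [← Set.coe_fintypeCard]
  exact_mod_cast h1

/-! ### Sides of a line and jumps across it -/

/-- A point is on the line through `P` with direction `d` if and only if this is zero. -/
def lineSide (P d x : Plane) : ℝ := (x 0 - P 0) * d 1 - (x 1 - P 1) * d 0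

/-- A vector that is orthogonal to `d`. -/
def normalVec (d : Plane) : Plane := !₂[d 1, -d 0]

theorem sq_add_sq_pos {d : Plane} (hd : d ≠ 0) : 0 < d 0 ^ 2 + d 1 ^ 2 := by
  by_contra! h
  apply hd
  ext i
  fin_cases i
  · simp; nlinarith [sq_nonneg (d 0), sq_nonneg (d 1)]
  · simp; nlinarith [sq_nonneg (d 0), sq_nonneg (d 1)]

theorem lineSide_add_smul (P d x : Plane) (s : ℝ) :
    lineSide P d (x + s • normalVec d) = lineSide P d x + s * (d 0 ^ 2 + d 1 ^ 2) := by
  simp [lineSide, normalVec]; ring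

theorem lineSide_line (P d : Plane) (t : ℝ) : lineSide P d (P + t • d) = 0 := by
  simp [lineSide]; ring

theorem lineSide_combo (P d : Plane) {x y : Plane} {a b : ℝ} (hab : a + b = 1) :
    lineSide P d (a • x + b • y) = a * lineSide P d x + b * lineSide P d y := by
  obtain rfl : b = 1 - a := by linarith
  simp [lineSide]; ring

theorem convex_lineSide_pos (P d : Plane) : Convex ℝ {x | 0 < lineSide P d x} := by
  intro x hx y hy a b ha hb hab
  simp only [mem_ofPred_eq] at *
  rw [lineSide_combo P d hab]
  rcases ha.eq_or_lt with rfl | ha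
  · obtain rfl : b = 1 := by linarith
    simpa
  · nlinarith [mul_pos ha hx, mul_nonneg hb hy.le]

theorem convex_lineSide_neg (P d : Plane) : Convex ℝ {x | lineSide P d x < 0} := by
  intro x hx y hy a b ha hb hab
  simp only [mem_ofPred_eq] at *
  rw [lineSide_combo P d hab]
  rcases ha.eq_or_lt with rfl | ha
  · obtain rfl : b = 1 := by linarith
    simpa
  · nlinarith [mul_neg_of_pos_of_neg ha hx, mul_nonpos_of_nonneg_of_nonpos hb hy.le]

theorem tendsto_add_smul_nhdsGT (x v : Plane) :
    Tendsto (fun s : ℝ => x + s • v) (𝓝[>] 0) (𝓝 x) := by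
  have : Continuous (fun s : ℝ => x + s • v) := by fun_prop
  simpa using (this.tendsto 0).mono_left nhdsWithin_le_nhds

theorem frequently_lineSide_pos {P d x : Plane} (hd : d ≠ 0) (hx : lineSide P d x = 0) :
    ∃ᶠ y in 𝓝 x, 0 < lineSide P d y := by
  refine (tendsto_add_smul_nhdsGT x (normalVec d)).frequently (Eventually.frequently ?_)
  filter_upwards [self_mem_nhdsWithin] with s hs
  rw [lineSide_add_smul, hx, zero_add]
  exact mul_pos hs (sq_add_sq_pos hd)

theorem frequently_lineSide_neg {P d x : Plane} (hd : d ≠ 0) (hx : lineSide P d x = 0) :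
    ∃ᶠ y in 𝓝 x, lineSide P d y < 0 := by
  refine (tendsto_add_smul_nhdsGT x (-normalVec d)).frequently (Eventually.frequently ?_)
  filter_upwards [self_mem_nhdsWithin] with s hs
  rw [smul_neg, ← neg_smul, lineSide_add_smul, hx, zero_add]
  exact mul_neg_of_neg_of_pos (neg_neg_of_pos hs) (sq_add_sq_pos hd)

theorem frequently_lineSide_ne {P d : Plane} (hd : d ≠ 0) (x : Plane) :
    ∃ᶠ y in 𝓝 x, lineSide P d y ≠ 0 := by
  by_cases hx : lineSide P d x = 0
  · exact (frequently_lineSide_pos hd hx).mono fun _ h => h.ne'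
  · exact fun h => (h.self_of_nhds) hx

/-- Near `x`, the function `f` takes the same value on both sides of a line. -/
def NoJump (P d : Plane) (f : Plane → ℝ) (x : Plane) : Prop :=
  ∃ c, ∀ᶠ y in 𝓝 x, lineSide P d y ≠ 0 → f y = c

theorem noJump_of_notMem {P d : Plane} {S : Set Plane} {f : Plane → ℝ} (hf : f ∈ locConst S)
    {x : Plane} (hx : x ∉ S) : NoJump P d f x :=
  ⟨f x, (hf.2 x hx).mono fun _ h _ => h⟩

section Step

variable {P d : Plane} {S A : Set Plane} {f : Plane → ℝ}

/-- Each open half of the disc is convex and avoids both `S` and the line that contains `A`. -/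
theorem exists_values_of_ball (hA : ∀ x ∈ A, lineSide P d x = 0) (hf : f ∈ locConst (S ∪ A))
    {x : Plane} {r : ℝ} (hr : Metric.ball x r ⊆ Sᶜ) :
    ∃ c₁ c₂, ∀ y ∈ Metric.ball x r,
      (0 < lineSide P d y → f y = c₁) ∧ (lineSide P d y < 0 → f y = c₂) := by
  have key : ∀ H : Set Plane, Convex ℝ H → (∀ y ∈ H, lineSide P d y ≠ 0) →
      ∃ c, ∀ y ∈ Metric.ball x r, y ∈ H → f y = c := by
    intro H hH hH'
    have hpre : IsPreconnected (Metric.ball x r ∩ H) :=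
      ((convex_ball x r).inter hH).isPreconnected
    have hsub : Metric.ball x r ∩ H ⊆ (S ∪ A)ᶜ := by
      rintro y ⟨hy, hyH⟩ (h | h)
      · exact hr hy h
      · exact hH' y hyH (hA y h)
    by_cases hne : (Metric.ball x r ∩ H).Nonempty
    · obtain ⟨z, hz⟩ := hne
      exact ⟨f z, fun y hy hyH => eq_of_mem_locConst hf hpre hsub ⟨hy, hyH⟩ hz⟩
    · exact ⟨0, fun y hy hyH => (hne ⟨y, hy, hyH⟩).elim⟩
  obtain ⟨c₁, h₁⟩ := key _ (convex_lineSide_pos P d) fun y hy => ne_of_gt hy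
  obtain ⟨c₂, h₂⟩ := key _ (convex_lineSide_neg P d) fun y hy => ne_of_lt hy
  exact ⟨c₁, c₂, fun y hy => ⟨h₁ y hy, h₂ y hy⟩⟩

theorem noJump_iff_of_ball (hd : d ≠ 0) {x : Plane} {r c₁ c₂ : ℝ}
    (h : ∀ y ∈ Metric.ball x r,
      (0 < lineSide P d y → f y = c₁) ∧ (lineSide P d y < 0 → f y = c₂))
    {y : Plane} (hy : y ∈ Metric.ball x r) (hy0 : lineSide P d y = 0) :
    NoJump P d f y ↔ c₁ = c₂ := by
  have hb : ∀ᶠ z in 𝓝 y, z ∈ Metric.ball x r := Metric.isOpen_ball.mem_nhds hy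
  constructor
  · rintro ⟨c, hc⟩
    obtain ⟨z, hz, hz', hzb⟩ := ((frequently_lineSide_pos hd hy0).and_eventually (hc.and hb)).exists
    obtain ⟨w, hw, hw', hwb⟩ := ((frequently_lineSide_neg hd hy0).and_eventually (hc.and hb)).exists
    rw [← (h z hzb).1 hz, ← (h w hwb).2 hw, hz' hz.ne', hw' hw.ne]
  · rintro rfl
    refine ⟨c₁, hb.mono fun z hz hne => ?_⟩
    rcases lt_or_gt_of_ne hne with h0 | h0
    · exact (h z hz).2 h0
    · exact (h z hz).1 h0

/-- In a disc that avoids `S`, the two half-disc values decide about a jump at all points of the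
line simultaneously. So having a jump is a locally constant property along the line. -/
theorem noJump_iff_of_isPreconnected (hd : d ≠ 0) (hS : IsClosed S)
    (hA : ∀ x ∈ A, lineSide P d x = 0) (hf : f ∈ locConst (S ∪ A)) {U : Set Plane}
    (hU : IsPreconnected U) (hUS : U ⊆ Sᶜ) (hUL : ∀ x ∈ U, lineSide P d x = 0) {x y : Plane}
    (hx : x ∈ U) (hy : y ∈ U) : NoJump P d f x ↔ NoJump P d f y := by
  refine Eq.to_iff (eq_of_isPreconnected_of_eventually_eq (f := fun x => NoJump P d f x) hU
    (fun z hz => ?_) hx hy)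
  obtain ⟨r, hr, hr'⟩ := Metric.isOpen_iff.1 hS.isOpen_compl z (hUS hz)
  obtain ⟨c₁, c₂, h⟩ := exists_values_of_ball hA hf hr'
  filter_upwards [self_mem_nhdsWithin,
    mem_nhdsWithin_of_mem_nhds (Metric.ball_mem_nhds z hr)] with w hw hwb
  exact propext ((noJump_iff_of_ball hd h hwb (hUL w hw)).trans
    (noJump_iff_of_ball hd h (Metric.mem_ball_self hr) (hUL z hz)).symm)

/-- Makes the absence of a jump a linear condition: a single difference of two values must vanish.
-/
theorem exists_sample (hd : d ≠ 0) (hS : IsClosed S) (hA : ∀ x ∈ A, lineSide P d x = 0)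
    {x : Plane} (hx : x ∉ S) (hx0 : lineSide P d x = 0) :
    ∃ y z : Plane, ∀ f ∈ locConst (S ∪ A), f y = f z → NoJump P d f x := by
  obtain ⟨r, hr, hr'⟩ := Metric.isOpen_iff.1 hS.isOpen_compl x hx
  have hb : ∀ᶠ z in 𝓝 x, z ∈ Metric.ball x r := Metric.ball_mem_nhds x hr
  obtain ⟨y, hy, hyb⟩ := ((frequently_lineSide_pos hd hx0).and_eventually hb).exists
  obtain ⟨z, hz, hzb⟩ := ((frequently_lineSide_neg hd hx0).and_eventually hb).exists
  refine ⟨y, z, fun f hf hyz => ?_⟩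
  obtain ⟨c₁, c₂, h⟩ := exists_values_of_ball hA hf hr'
  rw [noJump_iff_of_ball hd h (Metric.mem_ball_self hr) hx0, ← (h y hyb).1 hy, ← (h z hzb).2 hz,
    hyz]

/-- Restriction of locally constant functions to the complement of a larger set. -/
def restrictLocConst (S A : Set Plane) (hA : IsClosed A) :
    locConst S →ₗ[ℝ] locConst (S ∪ A) where
  toFun f := ⟨Aᶜ.indicator f, by
    refine ⟨fun x hx => ?_, fun x hx => ?_⟩
    · by_cases h : x ∈ Aᶜ
      · rw [indicator_of_mem h]; exact f.2.1 x (hx.resolve_right h)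
      · exact indicator_of_notMem h _
    · have hxA : x ∈ Aᶜ := fun h => hx (Or.inr h)
      filter_upwards [f.2.2 x fun h => hx (Or.inl h), hA.isOpen_compl.mem_nhds hxA] with y h₁ h₂
      rw [indicator_of_mem hxA, indicator_of_mem h₂, h₁]⟩
  map_add' f g := Subtype.ext (indicator_add _ _ _)
  map_smul' c f := Subtype.ext (indicator_const_smul Aᶜ c (f : Plane → ℝ))

theorem mem_range_restrictLocConst (hd : d ≠ 0) (hS : IsClosed S) (hAc : IsClosed A)
    (hf : f ∈ locConst (S ∪ A)) (h : ∀ x ∉ S, NoJump P d f x) :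
    (⟨f, hf⟩ : locConst (S ∪ A)) ∈ LinearMap.range (restrictLocConst S A hAc) := by
  classical
  have huniq : ∀ {x : Plane} {c c' : ℝ}, (∀ᶠ y in 𝓝 x, lineSide P d y ≠ 0 → f y = c) →
      (∀ᶠ y in 𝓝 x, lineSide P d y ≠ 0 → f y = c') → c = c' := by
    intro x c c' h₁ h₂
    obtain ⟨y, hy, h₁, h₂⟩ := ((frequently_lineSide_ne (P := P) hd x).and_eventually
      (h₁.and h₂)).exists
    exact (h₁ hy).symm.trans (h₂ hy)
  -- The extension takes the value that `f` has near the point on both sides of the line.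
  let g : Plane → ℝ := fun x => if hx : x ∈ S then 0 else (h x hx).choose
  have hg : ∀ x ∉ S, ∀ᶠ y in 𝓝 x, lineSide P d y ≠ 0 → f y = g x := by
    intro x hx
    simpa [g, hx] using (h x hx).choose_spec
  have hgm : g ∈ locConst S := by
    refine ⟨fun x hx => by simp [g, hx], fun x hx => ?_⟩
    filter_upwards [(hg x hx).eventually_nhds, hS.isOpen_compl.mem_nhds hx] with y h₁ h₂
    exact huniq (hg y h₂) h₁
  refine ⟨⟨g, hgm⟩, Subtype.ext (funext fun x => ?_)⟩
  change Aᶜ.indicator g x = f x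
  by_cases hxA : x ∈ A
  · rw [indicator_of_notMem (by simpa using hxA), hf.1 x (Or.inr hxA)]
  · rw [indicator_of_mem (by simpa using hxA)]
    by_cases hxS : x ∈ S
    · rw [hf.1 x (Or.inl hxS), hgm.1 x hxS]
    · refine huniq (hg x hxS) ((hf.2 x ?_).mono fun _ h _ => h)
      rintro (h | h) <;> contradiction

/-- Rank-nullity for the map that records the sampled differences: its kernel consists of functions
without jumps, which come from `locConst S`. -/
theorem rank_locConst_union_le (hd : d ≠ 0) (hS : IsClosed S) (hAc : IsClosed A)
    (hA : ∀ x ∈ A, lineSide P d x = 0) {ι : Type} [Fintype ι] (p : ι → Plane)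
    (hpS : ∀ i, p i ∉ S) (hpL : ∀ i, lineSide P d (p i) = 0)
    (h : ∀ f ∈ locConst (S ∪ A), (∀ i, NoJump P d f (p i)) → ∀ x ∉ S, NoJump P d f x) :
    Module.rank ℝ (locConst (S ∪ A)) ≤ Module.rank ℝ (locConst S) + Fintype.card ι := by
  choose y z hyz using fun i => exists_sample hd hS hA (hpS i) (hpL i)
  let Φ : locConst (S ∪ A) →ₗ[ℝ] (ι → ℝ) :=
    (LinearMap.funLeft ℝ ℝ y - LinearMap.funLeft ℝ ℝ z) ∘ₗ (locConst (S ∪ A)).subtype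
  have hker : LinearMap.ker Φ ≤ LinearMap.range (restrictLocConst S A hAc) := by
    rintro ⟨f, hf⟩ hfk
    refine mem_range_restrictLocConst hd hS hAc hf (h f hf fun i => hyz i f hf ?_)
    have := congrFun (LinearMap.mem_ker.1 hfk) i
    exact sub_eq_zero.1 this
  rw [← LinearMap.rank_range_add_rank_ker Φ, add_comm]
  refine add_le_add ((Submodule.rank_mono hker).trans ?_) ((Submodule.rank_le _).trans ?_)
  · exact LinearMap.rank_le_domain _
  · rw [rank_fun']

end Step

/-! ### Components of a line minus convex sets, and the effect of one more arm -/

/-- Let `T` be the complement of the union of `m` closed intervals, and let `J` be an interval. Then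
all components of `T` that are contained in `J` meet a small set of sample points. -/
theorem exists_samples_of_intervals {ι : Type} [Fintype ι] (I : ι → Set ℝ)
    (hI : ∀ j, IsClosed (I j)) (hI' : ∀ j, (I j).OrdConnected) (lb ub : Prop)
    [Decidable lb] [Decidable ub] (hne : lb → ub → Nonempty ι) :
    ∃ (κ : Type) (_ : Fintype κ) (s : κ → ℝ),
      Fintype.card κ + (if lb then 1 else 0) + (if ub then 1 else 0) ≤ Fintype.card ι + 1 ∧
      (∀ i, s i ∉ ⋃ j, I j) ∧
      ∀ N : ℝ → Prop, (∀ t ∉ ⋃ j, I j, ¬((lb → 0 ≤ t) ∧ (ub → t ≤ 1)) → N t) →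
        (∀ t t', t ≤ t' → Icc t t' ⊆ (⋃ j, I j)ᶜ → (N t ↔ N t')) →
        (∀ i, N (s i)) → ∀ t ∉ ⋃ j, I j, N t := by
  classical
  set T : Set ℝ := (⋃ j, I j)ᶜ with hT
  have hTc : IsClosed (⋃ j, I j) := isClosed_iUnion_of_finite hI
  have hTo : IsOpen T := hTc.isOpen_compl
  -- the component of `t` begins at the right end of `I j`, or at `-∞`, and does not leave `J`
  let W : Option ι → ℝ → Prop := fun o t => t ∈ T ∧ ((lb → 0 ≤ t) ∧ (ub → t ≤ 1)) ∧
    (ub → ∃ s ∈ Ioc t 1, s ∉ T) ∧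
    match o with
    | none => ¬lb ∧ Iic t ⊆ T
    | some j => ∃ c ∈ I j, c < t ∧ Ioc c t ⊆ T
  let E : Finset (Option ι) := Finset.univ.filter fun o => ∃ t, W o t
  have hE : ∀ o : E, ∃ t, W o t := fun o => (Finset.mem_filter.1 o.2).2
  choose s hs using hE
  -- If `I j` had a point beyond `c`, it would enter the component by order-connectedness. So `c` is
  -- the right end of `I j`, and the label `some j` determines the component.
  have hmax : ∀ {j c t}, c ∈ I j → c < t → Ioc c t ⊆ T → ∀ x ∈ I j, x ≤ c := by
    intro j c t hc hct hsub x hx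
    by_contra! hcx
    have h1 : min x t ∈ I j := (hI' j).out hc hx ⟨le_min hcx.le hct.le, min_le_left _ _⟩
    exact hsub ⟨lt_min hcx hct, min_le_right _ _⟩ (mem_iUnion.2 ⟨j, h1⟩)
  refine ⟨E, inferInstance, s, ?_, fun i => (hs i).1, ?_⟩
  · rw [Fintype.card_coe]
    have hnone : lb → none ∉ E := by
      intro h hmem
      obtain ⟨t, ht⟩ := (Finset.mem_filter.1 hmem).2
      exact ht.2.2.2.1 h
    -- An end at 1 spoils one more label. If every interval began a component that ends by 1, the
    -- one with the largest right end would be followed by a point of another interval, with a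
    -- larger right end.
    have hub : ub → ∃ o ∉ E, (lb → o ≠ none) := by
      intro hub
      by_contra! hall
      by_cases hι : Nonempty ι
      · have hj : ∀ j : ι, ∃ t c, W (some j) t ∧ c ∈ I j ∧ c < t ∧ Ioc c t ⊆ T := fun j => by
          by_contra hcon
          refine Option.some_ne_none j (hall (some j) fun hmem => hcon ?_).2
          obtain ⟨t, ht⟩ := (Finset.mem_filter.1 hmem).2
          obtain ⟨c, hc⟩ := ht.2.2.2
          exact ⟨t, c, ht, hc⟩
        choose t c ht hc using hj
        obtain ⟨j, hjmax⟩ := Finite.exists_max c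
        obtain ⟨x, hx, hxT⟩ := (ht j).2.2.1 hub
        obtain ⟨j', hj'⟩ := mem_iUnion.1 (not_not.1 hxT)
        have := hmax (hc j').1 (hc j').2.1 (hc j').2.2 x hj'
        linarith [hjmax j', hx.1, (hc j).2.1]
      -- Without intervals nothing can end a component, so `none` is the spoiled label; `hne` rules
      -- out that a beginning spoils it as well.
      · by_cases hlb : lb
        · exact hι (hne hlb hub)
        · have := hall none
          have h2 : (none : Option ι) ∈ E := by
            by_contra h2
            exact hlb (this h2).1
          obtain ⟨t, ht⟩ := (Finset.mem_filter.1 h2).2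
          obtain ⟨x, hx, hxT⟩ := ht.2.2.1 hub
          obtain ⟨j', hj'⟩ := mem_iUnion.1 (not_not.1 hxT)
          exact hι ⟨j'⟩
    have hcard : (Finset.univ : Finset (Option ι)).card = Fintype.card ι + 1 := by simp
    by_cases h1 : lb <;> by_cases h2 : ub
    · obtain ⟨o, ho, ho'⟩ := hub h2
      have : (insert none (insert o E)).card ≤ Fintype.card ι + 1 :=
        hcard ▸ Finset.card_le_univ _
      rw [Finset.card_insert_of_notMem, Finset.card_insert_of_notMem ho] at this
      · simpa [h1, h2] using this
      · simp [hnone h1, (ho' h1).symm]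
    · have : (insert none E).card ≤ Fintype.card ι + 1 := hcard ▸ Finset.card_le_univ _
      rw [Finset.card_insert_of_notMem (hnone h1)] at this
      simpa [h1, h2] using this
    · obtain ⟨o, ho, -⟩ := hub h2
      have : (insert o E).card ≤ Fintype.card ι + 1 := hcard ▸ Finset.card_le_univ _
      rw [Finset.card_insert_of_notMem ho] at this
      simpa [h1, h2] using this
    · simpa [h1, h2] using (hcard ▸ Finset.card_le_univ E : E.card ≤ Fintype.card ι + 1)
  · intro N hout hconn hsam t htT
    have htT' : t ∈ T := htT
    by_cases hJ : (lb → 0 ≤ t) ∧ (ub → t ≤ 1)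
    swap
    · exact hout t htT hJ
    by_cases hexit : ub → ∃ s ∈ Ioc t 1, s ∉ T
    swap
    -- The component contains 1 and is open, so it leaves `J` on the right, where `hout` applies.
    · push Not at hexit
      obtain ⟨hub, hexit⟩ := hexit
      have h1T : (1 : ℝ) ∈ T := by
        rcases (hJ.2 hub).eq_or_lt with h | h
        · rwa [← h]
        · exact hexit 1 ⟨h, le_rfl⟩
      obtain ⟨r, hr, hr'⟩ := Metric.isOpen_iff.1 hTo 1 h1T
      have hsub : Icc t (1 + r / 2) ⊆ T := by
        intro x hx
        rcases hx.1.eq_or_lt with h | h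
        · rwa [← h]
        rcases le_or_gt x 1 with h' | h'
        · exact hexit x ⟨h, h'⟩
        · apply hr'
          rw [Metric.mem_ball, Real.dist_eq, abs_of_pos (by linarith)]
          linarith [hx.2]
      have hle : t ≤ 1 + r / 2 := by linarith [hJ.2 hub]
      refine (hconn _ _ hle hsub).2 (hout _ (hsub ⟨hle, le_rfl⟩) fun h => ?_)
      linarith [h.2 hub]
    by_cases hleft : Iic t ⊆ T
    · by_cases hlb : lb
      · have hle : min t (-1) ≤ t := min_le_left _ _
        refine (hconn _ _ hle fun x hx => hleft hx.2).1 (hout _ (hleft hle) fun h => ?_)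
        have := h.1 hlb
        linarith [min_le_right t (-1)]
      · have hW : W none t := ⟨htT, hJ, hexit, hlb, hleft⟩
        have hmem : (none : Option ι) ∈ E := Finset.mem_filter.2 ⟨Finset.mem_univ _, t, hW⟩
        have h1 := hsam ⟨none, hmem⟩
        have h2 : Iic (s ⟨none, hmem⟩) ⊆ T := (hs ⟨none, hmem⟩).2.2.2.2
        rcases le_total t (s ⟨none, hmem⟩) with h | h
        · exact (hconn _ _ h fun x hx => h2 hx.2).2 h1
        · exact (hconn _ _ h fun x hx => hleft hx.2).1 h1
    · obtain ⟨x, hxt, hxT⟩ := not_subset.1 hleft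
      -- The component of `t` begins at the last point of the intervals before `t`.
      have hcl : IsClosed ((⋃ j, I j) ∩ Iic t) := hTc.inter isClosed_Iic
      have hbd : BddAbove ((⋃ j, I j) ∩ Iic t) := ⟨t, fun y hy => hy.2⟩
      have hcm := hcl.csSup_mem ⟨x, not_not.1 hxT, hxt⟩ hbd
      set c := sSup ((⋃ j, I j) ∩ Iic t)
      obtain ⟨j, hj⟩ := mem_iUnion.1 hcm.1
      have hct : c < t := lt_of_le_of_ne hcm.2 fun h => htT (h ▸ hcm.1)
      have hcT : Ioc c t ⊆ T := fun y hy hyT =>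
        absurd (le_csSup hbd ⟨hyT, hy.2⟩) (not_le.2 hy.1)
      have hW : W (some j) t := ⟨htT, hJ, hexit, c, hj, hct, hcT⟩
      have hmem : (some j : Option ι) ∈ E := Finset.mem_filter.2 ⟨Finset.mem_univ _, t, hW⟩
      have h1 := hsam ⟨some j, hmem⟩
      obtain ⟨c', hc', hct', hcT'⟩ := (hs ⟨some j, hmem⟩).2.2.2
      have hcc : c = c' :=
        le_antisymm (hmax hc' hct' hcT' c hj) (hmax hj hct hcT c' hc')
      subst hcc
      rcases le_total t (s ⟨some j, hmem⟩) with h | h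
      · exact (hconn _ _ h fun x hx => hcT' ⟨hct.trans_le hx.1, hx.2⟩).2 h1
      · exact (hconn _ _ h fun x hx => hcT ⟨hct'.trans_le hx.1, hx.2⟩).1 h1

namespace Chain

variable {k : ℕ}

theorem dir_ne_zero (C : Chain k) (i : Fin k) : C.dir i ≠ 0 := sub_ne_zero.2 (C.ne i).symm

theorem lineMap_eq (C : Chain k) (i : Fin k) (t : ℝ) :
    AffineMap.lineMap (C.pt i.castSucc) (C.pt i.succ) t = C.pt i.castSucc + t • C.dir i := by
  rw [AffineMap.lineMap_apply, vsub_eq_sub, vadd_eq_add, add_comm, dir]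

theorem mem_arm {C : Chain k} {i : Fin k} {x : Plane} : x ∈ C.arm i ↔
    ∃ s : ℝ, ((0 < (i : ℕ) → 0 ≤ s) ∧ ((i : ℕ) + 1 < k → s ≤ 1)) ∧
      C.pt i.castSucc + s • C.dir i = x := by
  simp only [arm, mem_image, mem_ofPred_eq, lineMap_eq]

theorem mem_openArm {C : Chain k} {i : Fin k} {x : Plane} : x ∈ C.openArm i ↔
    ∃ s : ℝ, ((0 < (i : ℕ) → 0 < s) ∧ ((i : ℕ) + 1 < k → s < 1)) ∧
      C.pt i.castSucc + s • C.dir i = x := by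
  simp only [openArm, mem_image, mem_ofPred_eq, lineMap_eq]

theorem openArm_subset_arm (C : Chain k) (i : Fin k) : C.openArm i ⊆ C.arm i :=
  image_mono fun _ hs => ⟨fun h => (hs.1 h).le, fun h => (hs.2 h).le⟩

theorem add_smul_dir_injective (C : Chain k) (i : Fin k) :
    Function.Injective fun s : ℝ => C.pt i.castSucc + s • C.dir i := fun s t h => by
  simpa [C.dir_ne_zero i] using h

theorem add_smul_dir_mem_arm {C : Chain k} {i : Fin k} {s : ℝ} :
    C.pt i.castSucc + s • C.dir i ∈ C.arm i ↔
      (0 < (i : ℕ) → 0 ≤ s) ∧ ((i : ℕ) + 1 < k → s ≤ 1) := by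
  rw [mem_arm]
  refine ⟨?_, fun h => ⟨s, h, rfl⟩⟩
  rintro ⟨t, ht, hts⟩
  rwa [← C.add_smul_dir_injective i hts]

theorem isClosed_arm (C : Chain k) (i : Fin k) : IsClosed (C.arm i) := by
  have h : IsClosed {s : ℝ | (0 < (i : ℕ) → 0 ≤ s) ∧ ((i : ℕ) + 1 < k → s ≤ 1)} := by
    have h1 : IsClosed {s : ℝ | 0 < (i : ℕ) → 0 ≤ s} := by
      by_cases h : 0 < (i : ℕ)
      · simpa only [h, true_imp_iff, Ici_def] using isClosed_Ici (a := (0 : ℝ))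
      · simp [h]
    have h2 : IsClosed {s : ℝ | (i : ℕ) + 1 < k → s ≤ 1} := by
      by_cases h : (i : ℕ) + 1 < k
      · simpa only [h, true_imp_iff, Iic_def] using isClosed_Iic (a := (1 : ℝ))
      · simp [h]
    exact h1.inter h2
  have h3 : Topology.IsClosedEmbedding fun s : ℝ => C.pt i.castSucc + s • C.dir i :=
    (Homeomorph.addLeft (C.pt i.castSucc)).isClosedEmbedding.comp
      (isClosedEmbedding_smul_left (C.dir_ne_zero i))
  have h4 := h3.isClosedMap _ h
  convert h4 using 1
  ext x
  rw [mem_arm]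
  rfl

theorem convex_arm (C : Chain k) (i : Fin k) : Convex ℝ (C.arm i) := by
  refine Convex.affine_image _ ?_
  have h1 : Convex ℝ {s : ℝ | 0 < (i : ℕ) → 0 ≤ s} := by
    by_cases h : 0 < (i : ℕ)
    · simpa only [h, true_imp_iff, Ici_def] using convex_Ici (0 : ℝ)
    · simpa [h] using convex_univ
  have h2 : Convex ℝ {s : ℝ | (i : ℕ) + 1 < k → s ≤ 1} := by
    by_cases h : (i : ℕ) + 1 < k
    · simpa only [h, true_imp_iff, Iic_def] using convex_Iic (1 : ℝ)
    · simpa [h] using convex_univ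
  exact h1.inter h2

theorem isClosed_carrier (C : Chain k) : IsClosed C.carrier :=
  isClosed_iUnion_of_finite C.isClosed_arm

/-- Adding an arm to `m` convex sets adds at most `m + 1` regions, and one fewer for each of the two
ends that the arm has. -/
theorem rank_locConst_union_arm_le (C : Chain k) (i : Fin k) {ι : Type} [Fintype ι]
    {B : ι → Set Plane} (hBc : ∀ j, IsClosed (B j)) (hB : ∀ j, Convex ℝ (B j))
    (hne : 0 < (i : ℕ) → Nonempty ι) {N : ℕ}
    (hN : Module.rank ℝ (locConst (⋃ j, B j)) ≤ N) :
    ∃ N' : ℕ, Module.rank ℝ (locConst ((⋃ j, B j) ∪ C.arm i)) ≤ N' ∧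
      N' + (if 0 < (i : ℕ) then 1 else 0) + (if (i : ℕ) + 1 < k then 1 else 0) ≤
        N + Fintype.card ι + 1 := by
  set P := C.pt i.castSucc with hP
  set d := C.dir i with hd
  have hd0 : d ≠ 0 := C.dir_ne_zero i
  let a : ℝ →ᵃ[ℝ] Plane := AffineMap.lineMap P (C.pt i.succ)
  have ha : ∀ t, a t = P + t • d := C.lineMap_eq i
  have hac : Continuous a := AffineMap.lineMap_continuous
  -- On the parameter line the earlier sets become closed intervals; `J` consists of the parameters
  -- of the arm, bounded on the sides where the arm has an end.
  obtain ⟨κ, _, s, hcard, hs, hs'⟩ := exists_samples_of_intervals (fun j => a ⁻¹' (B j))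
    (fun j => (hBc j).preimage hac) (fun j => ((hB j).affine_preimage a).ordConnected)
    (0 < (i : ℕ)) ((i : ℕ) + 1 < k) (fun h _ => hne h)
  have hT : ∀ t, t ∉ ⋃ j, a ⁻¹' (B j) ↔ a t ∉ ⋃ j, B j := fun t => by simp
  have hSc : IsClosed (⋃ j, B j) := isClosed_iUnion_of_finite hBc
  have hside : ∀ x ∈ C.arm i, lineSide P d x = 0 := by
    intro x hx
    obtain ⟨t, -, rfl⟩ := mem_arm.1 hx
    exact lineSide_line _ _ _
  refine ⟨N + Fintype.card κ, ?_, by omega⟩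
  push_cast
  refine (rank_locConst_union_le hd0 hSc (C.isClosed_arm i) hside (fun j => a (s j))
    (fun j => (hT _).1 (hs j)) (fun j => by rw [ha]; exact lineSide_line _ _ _) ?_).trans
    (add_le_add_left hN _)
  intro f hf hsam x hx
  by_cases hxA : x ∈ C.arm i
  swap
  · exact noJump_of_notMem hf (by rintro (h | h) <;> contradiction)
  obtain ⟨t, -, rfl⟩ := mem_arm.1 hxA
  rw [← hP, ← hd, ← ha] at hx ⊢
  refine hs' (fun t => NoJump P d f (a t)) (fun t ht hJ => ?_) (fun t t' htt' hsub => ?_) hsam t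
    ((hT t).2 hx)
  -- Where the line has left the arm, the function is locally constant.
  · refine noJump_of_notMem hf ?_
    rintro (h | h)
    · exact (hT t).1 ht h
    · rw [ha, hP, hd, add_smul_dir_mem_arm] at h
      exact hJ h
  · refine noJump_iff_of_isPreconnected hd0 hSc hside hf
      (isPreconnected_Icc.image a hac.continuousOn) ?_ ?_ ⟨t, left_mem_Icc.2 htt', rfl⟩
      ⟨t', right_mem_Icc.2 htt', rfl⟩
    · rintro _ ⟨u, hu, rfl⟩
      exact (hT u).1 (hsub hu)
    · rintro _ ⟨u, -, rfl⟩
      rw [ha]; exact lineSide_line _ _ _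

end Chain

/-! ### The upper bound for the number of regions -/

/-- The maximum number of regions formed by `n` `k`-chains. -/
def maxRegions (k n : ℕ) : ℕ := 1 + n + (n * (k - 1).choose 2 + n.choose 2 * k ^ 2)

theorem cast_maxRegions {k : ℕ} (hk : 1 ≤ k) (n : ℕ) : (maxRegions k n : ℝ) =
    (k : ℝ) ^ 2 * (n : ℝ) ^ 2 / 2 - 3 * (k : ℝ) * (n : ℝ) / 2 + 2 * (n : ℝ) + 1 := by
  rw [maxRegions]
  push_cast [Nat.cast_choose_two, Nat.cast_sub hk]
  ring

/-- In each block of `k` arms, all but the first have a beginning and all but the last have an end.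
-/
theorem sum_arm_ends {k : ℕ} (hk : 1 ≤ k) (n : ℕ) :
    ∑ j ∈ Finset.range (n * k), ((if 0 < j % k then 1 else 0) + (if j % k + 1 < k then 1 else 0))
      = n * (2 * (k - 1)) := by
  induction n with
  | zero => simp
  | succ n ih =>
    rw [add_one_mul, Finset.sum_range_add, ih, add_one_mul n (2 * (k - 1))]
    congr 1
    have : ∀ j ∈ Finset.range k, ((if 0 < (n * k + j) % k then 1 else 0) +
        (if (n * k + j) % k + 1 < k then 1 else 0)) =
        ((if 0 < j then 1 else 0) + (if j + 1 < k then 1 else 0)) := by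
      intro j hj
      have hj' := Finset.mem_range.1 hj
      rw [Nat.add_comm (n * k) j, Nat.add_mul_mod_self_right, Nat.mod_eq_of_lt hj']
    rw [Finset.sum_congr rfl this, Finset.sum_add_distrib]
    obtain ⟨k, rfl⟩ := Nat.exists_eq_add_of_le' hk
    rw [Finset.sum_range_succ', Finset.sum_range_succ]
    have h2 : ∀ j ∈ Finset.range k, (if j + 1 < k + 1 then 1 else 0) = 1 := by
      intro j hj
      have hj' := Finset.mem_range.1 hj
      simp [hj']
    rw [Finset.sum_congr rfl h2]
    simp
    omega

/-- The arms are drawn chain by chain, in the order along each chain. The `j`-th one (from 0) has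
`j` predecessors, so it adds at most `j + 1` dimensions minus its number of ends. -/
theorem chainRegionCount_le {k n : ℕ} (hk : 1 ≤ k) (C : Fin n → Chain k) :
    chainRegionCount C ≤ maxRegions k n := by
  have hmod : ∀ j, j % k < k := fun j => Nat.mod_lt _ hk
  have hdiv : ∀ {j}, j < n * k → j / k < n := fun h => (Nat.div_lt_iff_lt_mul hk).2 h
  let B : ℕ → Set Plane := fun j =>
    if h : j < n * k then (C ⟨j / k, hdiv h⟩).arm ⟨j % k, hmod j⟩ else ∅
  have hB : ∀ j (h : j < n * k), B j = (C ⟨j / k, hdiv h⟩).arm ⟨j % k, hmod j⟩ :=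
    fun j h => dif_pos h
  have hBc : ∀ j, IsClosed (B j) ∧ Convex ℝ (B j) := by
    intro j
    by_cases h : j < n * k
    · rw [hB j h]; exact ⟨Chain.isClosed_arm _ _, Chain.convex_arm _ _⟩
    · simp only [B, dif_neg h]; exact ⟨isClosed_empty, convex_empty⟩
  have key : ∀ m ≤ n * k, ∃ N : ℕ, Module.rank ℝ (locConst (⋃ j : Fin m, B j)) ≤ N ∧
      N + ∑ j ∈ Finset.range m,
        ((if 0 < j % k then 1 else 0) + (if j % k + 1 < k then 1 else 0)) ≤
        1 + ∑ j ∈ Finset.range m, (j + 1) := by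
    intro m
    induction m with
    | zero =>
      intro _
      refine ⟨1, ?_, by simp⟩
      have : (⋃ j : Fin 0, B j) = ∅ := iUnion_of_empty _
      rw [this]
      exact_mod_cast locConst_empty_rank
    | succ m ih =>
      intro hm
      obtain ⟨N, hN, hN'⟩ := ih (by omega)
      obtain ⟨N', h1, h2⟩ := Chain.rank_locConst_union_arm_le (C ⟨m / k, hdiv hm⟩) ⟨m % k, hmod m⟩
        -- The very first arm drawn has no beginning, so an arm with a beginning always has a
        -- predecessor.
        (fun j : Fin m => (hBc j).1) (fun j => (hBc j).2) (fun h => ⟨⟨0, by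
          by_contra h0
          obtain rfl : m = 0 := by omega
          simp at h⟩⟩) hN
      refine ⟨N', ?_, ?_⟩
      · have : (⋃ j : Fin (m + 1), B j) = (⋃ j : Fin m, B j) ∪ B m := by
          ext x
          simp only [mem_iUnion, mem_union, Fin.exists_fin_succ']
          simp
        rw [this, hB m hm]
        exact h1
      · rw [Finset.sum_range_succ, Finset.sum_range_succ]
        simp only [Fintype.card_fin] at h2
        omega
  obtain ⟨N, hN, hN'⟩ := key _ le_rfl
  have hU : (⋃ j : Fin (n * k), B j) = ⋃ i, (C i).carrier := by
    ext x
    simp only [mem_iUnion, Chain.carrier]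
    constructor
    · rintro ⟨j, hj⟩
      rw [hB j j.2] at hj
      exact ⟨_, _, hj⟩
    · rintro ⟨i, a, h⟩
      have hlt : (i : ℕ) * k + a < n * k := by
        calc (i : ℕ) * k + a < i * k + k := by omega
          _ = (i + 1) * k := by ring
          _ ≤ n * k := Nat.mul_le_mul_right _ i.2
      refine ⟨⟨i * k + a, hlt⟩, ?_⟩
      rw [hB _ hlt]
      have e1 : ((i : ℕ) * k + a) / k = i := by
        rw [Nat.add_comm, Nat.add_mul_div_right _ _ hk, Nat.div_eq_of_lt a.2, zero_add]
      have e2 : ((i : ℕ) * k + a) % k = a := by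
        rw [Nat.add_comm, Nat.add_mul_mod_self_right, Nat.mod_eq_of_lt a.2]
      simpa only [e1, e2] using h
  rw [hU] at hN
  refine (encard_planeRegions_le (isClosed_iUnion_of_finite fun i => (C i).isClosed_carrier)
    hN).trans ?_
  rw [sum_arm_ends hk] at hN'
  have h3 : ∀ m : ℕ, (∑ j ∈ Finset.range m, ((j : ℝ) + 1)) = m * (m + 1) / 2 := by
    intro m
    induction m with
    | zero => simp
    | succ m ih => rw [Finset.sum_range_succ, ih]; push_cast; ring
  have h4 : (N : ℝ) ≤ maxRegions k n := by
    rw [cast_maxRegions hk]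
    have h5 : ((N + n * (2 * (k - 1)) : ℕ) : ℝ) ≤
        ((1 + ∑ j ∈ Finset.range (n * k), (j + 1) : ℕ) : ℝ) := by exact_mod_cast hN'
    push_cast [Nat.cast_sub hk] at h5
    rw [h3] at h5
    push_cast at h5
    nlinarith
  exact_mod_cast h4

/-! ### View angles and their jumps -/

/-- The plane as the complex plane. -/
def planeToComplex : Plane →ₗ[ℝ] ℂ where
  toFun z := ⟨z 0, z 1⟩
  map_add' _ _ := by apply Complex.ext <;> simp
  map_smul' _ _ := by apply Complex.ext <;> simp

theorem planeToComplex_re (z : Plane) : (planeToComplex z).re = z 0 := rfl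

theorem planeToComplex_im (z : Plane) : (planeToComplex z).im = z 1 := rfl

theorem planeToComplex_eq_zero {z : Plane} : planeToComplex z = 0 ↔ z = 0 := by
  refine ⟨fun h => ?_, fun h => by simp [h]⟩
  ext i
  fin_cases i
  · simpa [planeToComplex_re] using congrArg Complex.re h
  · simpa [planeToComplex_im] using congrArg Complex.im h

theorem continuous_planeToComplex : Continuous planeToComplex :=
  planeToComplex.continuous_of_finiteDimensional

/-- The vector from `z` to `g.1` if `g.2 = 1`, and the direction `g.1` if `g.2 = 0`. -/
def toward (g : Plane × ℝ) (z : Plane) : ℂ := planeToComplex (g.1 - g.2 • z)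

theorem continuous_toward (g : Plane × ℝ) : Continuous (toward g) :=
  continuous_planeToComplex.comp (by fun_prop)

/-- The angle under which the oriented segment from `g` to `g'` is seen. -/
def viewAngle (g g' : Plane × ℝ) (z : Plane) : ℝ := (toward g' z / toward g z).arg

/-- The argument is discontinuous only where the ratio is zero or negative. Then a nontrivial
nonnegative combination of the two vectors vanishes, that is, `z` lies on the segment or ray. -/
theorem continuousAt_viewAngle {g g' : Plane × ℝ} {z : Plane}
    (h : ∀ a b : ℝ, 0 ≤ a → 0 ≤ b → a • toward g z + b • toward g' z = 0 → a = 0 ∧ b = 0) :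
    ContinuousAt (viewAngle g g') z := by
  have h0 : toward g z ≠ 0 := fun h0 => by
    have := (h 1 0 zero_le_one le_rfl (by simp [h0])).1
    norm_num at this
  refine ContinuousAt.comp (g := Complex.arg) (Complex.continuousAt_arg ?_)
    ((continuous_toward g').continuousAt.div (continuous_toward g).continuousAt h0)
  by_contra hs
  rw [Complex.mem_slitPlane_iff, not_or, not_lt, not_not] at hs
  obtain ⟨hre, him⟩ := hs
  set w := toward g' z / toward g z
  have hw : w = (w.re : ℂ) := Complex.ext (by simp) (by simp [him])
  have h1 : toward g' z = w.re * toward g z := by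
    rw [← hw, div_mul_cancel₀ _ h0]
  have := (h (-w.re) 1 (by linarith) zero_le_one (by rw [h1]; simp)).2
  norm_num at this

/-- The vertical unit vector. -/
def vertVec : Plane := !₂[0, 1]

/-- The function `f` jumps by `J` when a line is crossed at `p` upwards. -/
def HasJump (f : Plane → ℝ) (p : Plane) (J : ℝ) : Prop :=
  Tendsto (fun s : ℝ => f (p + s • vertVec) - f (p - s • vertVec)) (𝓝[>] 0) (𝓝 J)

theorem tendsto_sub_smul_nhdsGT (x v : Plane) :
    Tendsto (fun s : ℝ => x - s • v) (𝓝[>] 0) (𝓝 x) := by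
  simpa [sub_eq_add_neg] using tendsto_add_smul_nhdsGT x (-v)

theorem HasJump.of_continuousAt {f : Plane → ℝ} {p : Plane} (h : ContinuousAt f p) :
    HasJump f p 0 := by
  have := (h.tendsto.comp (tendsto_add_smul_nhdsGT p vertVec)).sub
    (h.tendsto.comp (tendsto_sub_smul_nhdsGT p vertVec))
  simpa [HasJump, Function.comp_def] using this

theorem HasJump.add {f g : Plane → ℝ} {p : Plane} {J K : ℝ} (hf : HasJump f p J)
    (hg : HasJump g p K) : HasJump (fun z => f z + g z) p (J + K) := by
  refine (Tendsto.add hf hg).congr fun s => ?_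
  ring

theorem HasJump.const_mul {f : Plane → ℝ} {p : Plane} {J : ℝ} (c : ℝ) (hf : HasJump f p J) :
    HasJump (fun z => c * f z) p (c * J) := by
  refine (Tendsto.const_mul c hf).congr fun s => ?_
  ring

theorem HasJump.sum {ι : Type*} {t : Finset ι} {f : ι → Plane → ℝ} {p : Plane} {J : ι → ℝ}
    (hf : ∀ i ∈ t, HasJump (f i) p (J i)) :
    HasJump (fun z => ∑ i ∈ t, f i z) p (∑ i ∈ t, J i) := by
  refine (tendsto_finsetSum t hf).congr fun s => ?_
  rw [Finset.sum_sub_distrib]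

theorem HasJump.unique {f : Plane → ℝ} {p : Plane} {J K : ℝ} (h : HasJump f p J)
    (h' : HasJump f p K) : J = K := tendsto_nhds_unique h h'

theorem toward_add_smul (g : Plane × ℝ) (z : Plane) (s : ℝ) :
    toward g (z + s • vertVec) = toward g z - (g.2 * s : ℝ) * Complex.I := by
  apply Complex.ext <;>
    simp [toward, vertVec, planeToComplex_re, planeToComplex_im]
  ring

theorem viewAngle_ratio_im {g g' : Plane × ℝ} {p : Plane} {d : ℂ} {a b : ℝ}
    (hg : toward g p = -(a * d)) (hg' : toward g' p = b * d) (s : ℝ) :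
    (toward g' (p + s • vertVec) / toward g (p + s • vertVec)).im =
      s * ((g'.2 * a + g.2 * b) * d.re) / Complex.normSq (toward g (p + s • vertVec)) := by
  rw [toward_add_smul, toward_add_smul, hg, hg', Complex.div_im, ← sub_div]
  congr 1
  simp
  ring

/-- Inside the segment or ray the two vectors point in opposite directions and the ratio is a
negative real. A vertical move crosses the branch cut, and the sign of `d.re` decides in which
direction. At least one node must be finite: between two nodes at infinity the ratio would not
depend on the point. -/
theorem hasJump_viewAngle {g g' : Plane × ℝ} {p : Plane} {d : ℂ} {a b : ℝ}
    (hg : toward g p = -(a * d)) (hg' : toward g' p = b * d) (ha : 0 < a) (hb : 0 < b)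
    (hd : d.re ≠ 0) (h : 0 ≤ g.2) (h' : 0 ≤ g'.2) (hne : g.2 ≠ 0 ∨ g'.2 ≠ 0) :
    HasJump (viewAngle g g') p (2 * Real.pi * SignType.sign d.re) := by
  have hd0 : d ≠ 0 := fun h => hd (by simp [h])
  have hg0 : toward g p ≠ 0 := by
    rw [hg, neg_ne_zero]
    exact mul_ne_zero (by exact_mod_cast ha.ne') hd0
  have hratio : toward g' p / toward g p = ((-(b / a) : ℝ) : ℂ) := by
    rw [hg, hg']
    have : (a : ℂ) ≠ 0 := by exact_mod_cast ha.ne'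
    push_cast
    field_simp
  have hre : (toward g' p / toward g p).re < 0 := by
    rw [hratio, Complex.ofReal_re]
    exact neg_neg_of_pos (div_pos hb ha)
  have him : (toward g' p / toward g p).im = 0 := by rw [hratio, Complex.ofReal_im]
  have hcont : ContinuousAt (fun z => toward g' z / toward g z) p :=
    (continuous_toward g').continuousAt.div (continuous_toward g).continuousAt hg0
  have hm : 0 < g'.2 * a + g.2 * b := by
    rcases hne with h0 | h0
    · have := mul_pos (lt_of_le_of_ne h (Ne.symm h0)) hb
      nlinarith [mul_nonneg h' ha.le]
    · have := mul_pos (lt_of_le_of_ne h' (Ne.symm h0)) ha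
      nlinarith [mul_nonneg h hb.le]
  have hns : ∀ᶠ z in 𝓝 p, 0 < Complex.normSq (toward g z) := by
    filter_upwards [(continuous_toward g).continuousAt.eventually_ne hg0] with z hz
    exact Complex.normSq_pos.2 hz
  have hup := tendsto_add_smul_nhdsGT p vertVec
  have hdn := tendsto_sub_smul_nhdsGT p vertVec
  have lim_pos : ∀ u : ℝ → Plane, Tendsto u (𝓝[>] 0) (𝓝 p) →
      (∀ᶠ s in 𝓝[>] 0, 0 < (toward g' (u s) / toward g (u s)).im) →
      Tendsto (fun s => viewAngle g g' (u s)) (𝓝[>] 0) (𝓝 Real.pi) := fun u hu hpos =>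
    (Complex.tendsto_arg_nhdsWithin_im_nonneg_of_re_neg_of_im_zero hre him).comp
      (tendsto_nhdsWithin_iff.2 ⟨hcont.tendsto.comp hu, hpos.mono fun _ hs => hs.le⟩)
  have lim_neg : ∀ u : ℝ → Plane, Tendsto u (𝓝[>] 0) (𝓝 p) →
      (∀ᶠ s in 𝓝[>] 0, (toward g' (u s) / toward g (u s)).im < 0) →
      Tendsto (fun s => viewAngle g g' (u s)) (𝓝[>] 0) (𝓝 (-Real.pi)) := fun u hu hneg =>
    (Complex.tendsto_arg_nhdsWithin_im_neg_of_re_neg_of_im_zero hre him).comp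
      (tendsto_nhdsWithin_iff.2 ⟨hcont.tendsto.comp hu, hneg⟩)
  have e : ∀ s : ℝ, p - s • vertVec = p + (-s) • vertVec := fun s => by
    rw [neg_smul, sub_eq_add_neg]
  rcases lt_or_gt_of_ne hd with hd | hd
  · have h1 := lim_neg _ hup (by
      filter_upwards [self_mem_nhdsWithin, hup.eventually hns] with s hs hn
      rw [viewAngle_ratio_im hg hg']
      exact div_neg_of_neg_of_pos
        (mul_neg_of_pos_of_neg hs (mul_neg_of_pos_of_neg hm hd)) hn)
    have h2 := lim_pos _ hdn (by
      filter_upwards [self_mem_nhdsWithin, hdn.eventually hns] with s hs hn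
      rw [e] at hn ⊢
      rw [viewAngle_ratio_im hg hg']
      exact div_pos (mul_pos_of_neg_of_neg (neg_neg_of_pos hs)
        (mul_neg_of_pos_of_neg hm hd)) hn)
    have h3 := h1.sub h2
    rw [sign_neg hd]
    unfold HasJump
    convert h3 using 2
    simp
    ring
  · have h1 := lim_pos _ hup (by
      filter_upwards [self_mem_nhdsWithin, hup.eventually hns] with s hs hn
      rw [viewAngle_ratio_im hg hg']
      exact div_pos (mul_pos hs (mul_pos hm hd)) hn)
    have h2 := lim_neg _ hdn (by
      filter_upwards [self_mem_nhdsWithin, hdn.eventually hns] with s hs hn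
      rw [e] at hn ⊢
      rw [viewAngle_ratio_im hg hg']
      exact div_neg_of_neg_of_pos (mul_neg_of_neg_of_pos (neg_neg_of_pos hs)
        (mul_pos hm hd)) hn)
    have h3 := h1.sub h2
    rw [sign_pos hd]
    unfold HasJump
    convert h3 using 2
    simp
    ring

/-! ### Angles of segments and rays on a line -/

/-- The point with parameter `o` on the line `{P + t • d}`, where `none` stands for the beginning of
the line, at infinity. -/
def startNode (P d : Plane) (o : Option ℝ) : Plane × ℝ :=
  o.elim (-d, 0) fun t => (P + t • d, 1)

/-- The point with parameter `o` on the line `{P + t • d}`, where `none` stands for the end of the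
line, at infinity. -/
def endNode (P d : Plane) (o : Option ℝ) : Plane × ℝ :=
  o.elim (d, 0) fun t => (P + t • d, 1)

/-- The part of a line with parameters between `lo` and `hi`, seen as an angle. -/
def pieceAngle (P d : Plane) (lo hi : Option ℝ) : Plane → ℝ :=
  viewAngle (startNode P d lo) (endNode P d hi)

/-- A vanishing nonnegative combination of the vectors to the two nodes exhibits `z` as a point of
the piece. A whole line has to be excluded, since `d` and `-d` cancel everywhere. -/
theorem continuousAt_pieceAngle {P d : Plane} (hd : d ≠ 0) {lo hi : Option ℝ}
    (hne : lo ≠ none ∨ hi ≠ none) (hle : ∀ t ∈ lo, ∀ u ∈ hi, t ≤ u) {z : Plane}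
    (hz : ∀ s : ℝ, (∀ t ∈ lo, t ≤ s) → (∀ u ∈ hi, s ≤ u) → z ≠ P + s • d) :
    ContinuousAt (pieceAngle P d lo hi) z := by
  refine continuousAt_viewAngle fun a b ha hb hab => ?_
  by_contra hcon
  have hpos : 0 < a + b := by
    rcases ha.eq_or_lt with rfl | ha
    · rcases hb.eq_or_lt with rfl | hb
      · simp at hcon
      · linarith
    · linarith
  simp only [toward, ← map_smul, ← map_add, planeToComplex_eq_zero] at hab
  rcases lo with _ | t <;> rcases hi with _ | u
  · simp at hne
  · simp only [startNode, endNode, Option.elim] at hab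
    rcases hb.eq_or_lt with rfl | hb
    · simp [hd, (show a ≠ 0 by linarith)] at hab
    -- Solves a(-d) + b(P + ud - z) = 0 for `z`.
    · refine hz (u - a / b) (by simp) (by simp; positivity) ?_
      have : b • z = b • (P + (u - a / b) • d) := by
        rw [smul_add, smul_smul, mul_sub, mul_div_cancel₀ _ hb.ne', ← sub_eq_zero, ← neg_eq_zero,
          ← hab]
        module
      exact (smul_right_injective _ hb.ne') this
  · simp only [startNode, endNode, Option.elim] at hab
    rcases ha.eq_or_lt with rfl | ha
    · simp [hd, (show b ≠ 0 by linarith)] at hab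
    · refine hz (t + b / a) (by simp; positivity) (by simp) ?_
      have : a • z = a • (P + (t + b / a) • d) := by
        rw [smul_add, smul_smul, mul_add, mul_div_cancel₀ _ ha.ne', ← sub_eq_zero, ← neg_eq_zero,
          ← hab]
        module
      exact (smul_right_injective _ ha.ne') this
  · simp only [startNode, endNode, Option.elim] at hab
    have htu : t ≤ u := hle t rfl u rfl
    -- The weighted mean of the two ends.
    refine hz ((a * t + b * u) / (a + b)) ?_ ?_ ?_
    · simp only [Option.mem_some_iff, forall_eq']
      rw [le_div_iff₀ hpos]; nlinarith
    · simp only [Option.mem_some_iff, forall_eq']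
      rw [div_le_iff₀ hpos]; nlinarith
    · have : (a + b) • z = (a + b) • (P + ((a * t + b * u) / (a + b)) • d) := by
        rw [smul_add, smul_smul, mul_div_cancel₀ _ hpos.ne', ← sub_eq_zero, ← neg_eq_zero, ← hab]
        module
      exact (smul_right_injective _ hpos.ne') this

theorem hasJump_pieceAngle {P d : Plane} (hd : d 0 ≠ 0) {lo hi : Option ℝ}
    (hne : lo ≠ none ∨ hi ≠ none) {s : ℝ} (hlo : ∀ t ∈ lo, t < s) (hhi : ∀ u ∈ hi, s < u) :
    HasJump (pieceAngle P d lo hi) (P + s • d) (2 * Real.pi * SignType.sign (d 0)) := by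
  have h1 : ∃ a : ℝ, 0 < a ∧ toward (startNode P d lo) (P + s • d) = -(a * planeToComplex d) := by
    rcases lo with _ | t
    · exact ⟨1, one_pos, by simp [toward, startNode]⟩
    · refine ⟨s - t, sub_pos.2 (hlo t rfl), ?_⟩
      simp [toward, startNode]
      ring
  have h2 : ∃ b : ℝ, 0 < b ∧ toward (endNode P d hi) (P + s • d) = b * planeToComplex d := by
    rcases hi with _ | u
    · exact ⟨1, one_pos, by simp [toward, endNode]⟩
    · refine ⟨u - s, sub_pos.2 (hhi u rfl), ?_⟩
      simp [toward, endNode]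
      ring
  obtain ⟨a, ha, ha'⟩ := h1
  obtain ⟨b, hb, hb'⟩ := h2
  refine hasJump_viewAngle ha' hb' ha hb hd ?_ ?_ ?_
  · rcases lo with _ | t <;> simp [startNode]
  · rcases hi with _ | t <;> simp [endNode]
  · rcases hne with h | h
    · obtain ⟨t, rfl⟩ := Option.ne_none_iff_exists'.1 h
      left; simp [startNode]
    · obtain ⟨t, rfl⟩ := Option.ne_none_iff_exists'.1 h
      right; simp [endNode]

theorem coe_viewAngle {g g' : Plane × ℝ} {z : Plane} (h : toward g z ≠ 0) (h' : toward g' z ≠ 0) :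
    (viewAngle g g' z : Real.Angle) = ((toward g' z).arg : Real.Angle) - (toward g z).arg :=
  Complex.arg_div_coe_angle h' h

/-- A continuous function whose values agree modulo 2π cannot vary by less than 2π without being
constant. -/
theorem indicator_mem_locConst_of_angle {S : Set Plane} (hS : IsClosed S) {f : Plane → ℝ}
    (hf : ∀ z ∉ S, ContinuousAt f z) {θ : Real.Angle} (hθ : ∀ z ∉ S, (f z : Real.Angle) = θ) :
    Sᶜ.indicator f ∈ locConst S := by
  refine ⟨fun z hz => indicator_of_notMem (by simpa using hz) _, fun z hz => ?_⟩
  have h1 : ∀ᶠ y in 𝓝 z, dist (f y) (f z) < 1 :=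
    (hf z hz).tendsto.eventually (Metric.ball_mem_nhds _ one_pos)
  filter_upwards [h1, hS.isOpen_compl.mem_nhds hz] with y hy hyS
  rw [indicator_of_mem hyS, indicator_of_mem (by simpa using hz)]
  obtain ⟨m, hm⟩ := Real.Angle.angle_eq_iff_two_pi_dvd_sub.1 ((hθ y hyS).trans (hθ z hz).symm)
  rw [Real.dist_eq, hm] at hy
  have hm0 : m = 0 := by
    by_contra hm0
    have h2 : (1 : ℝ) ≤ |(m : ℝ)| := by exact_mod_cast Int.one_le_abs hm0
    rw [abs_mul, abs_of_pos Real.two_pi_pos] at hy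
    nlinarith [Real.pi_gt_three]
  rw [hm0] at hm
  simp at hm
  linarith

theorem coe_pieceAngle {P d : Plane} (hd : d ≠ 0) {lo hi : Option ℝ}
    (hle : ∀ t ∈ lo, ∀ u ∈ hi, t ≤ u) {z : Plane}
    (hz : ∀ s : ℝ, (∀ t ∈ lo, t ≤ s) → (∀ u ∈ hi, s ≤ u) → z ≠ P + s • d) :
    (pieceAngle P d lo hi z : Real.Angle) =
      ((toward (endNode P d hi) z).arg : Real.Angle) - (toward (startNode P d lo) z).arg := by
  refine coe_viewAngle ?_ ?_
  · rcases lo with _ | t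
    · simpa [startNode, toward, planeToComplex_eq_zero] using hd
    · have := hz t (by simp) (hle t rfl)
      simpa [startNode, toward, planeToComplex_eq_zero, sub_eq_zero, -map_sub, -map_add]
        using this.symm
  · rcases hi with _ | u
    · simpa [endNode, toward, planeToComplex_eq_zero] using hd
    · have := hz u (fun t ht => hle t ht u rfl) (by simp)
      simpa [endNode, toward, planeToComplex_eq_zero, sub_eq_zero, -map_sub, -map_add]
        using this.symm

theorem Fin.sum_lt_telescope {G : Type*} [AddCommGroup G] {k : ℕ} {E F : Fin k → G}
    (h : ∀ (c : ℕ) (hc : c + 1 < k), E ⟨c, by omega⟩ = F ⟨c + 1, hc⟩) (a : ℕ) (ha : a < k) :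
    ∑ c with c < (⟨a, ha⟩ : Fin k), (E c - F c) = F ⟨a, ha⟩ - F ⟨0, by omega⟩ := by
  induction a with
  | zero =>
    rw [sub_self]
    refine Finset.sum_eq_zero fun c hc => ?_
    have := (Finset.mem_filter.1 hc).2
    simp [Fin.lt_def] at this
  | succ a ih =>
    have : Finset.univ.filter (fun c => c < (⟨a + 1, ha⟩ : Fin k)) =
        insert ⟨a, by omega⟩ (Finset.univ.filter fun c => c < (⟨a, by omega⟩ : Fin k)) := by
      ext c
      simp [Fin.lt_def, Fin.ext_iff]
      omega
    rw [this, Finset.sum_insert (by simp), ih (by omega), h a ha]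
    abel

/-- The total sum is split at `a` and at the last index; the lower parts are known from
`Fin.sum_lt_telescope`. -/
theorem Fin.sum_gt_telescope {G : Type*} [AddCommGroup G] {k : ℕ} {E F : Fin k → G}
    (h : ∀ (c : ℕ) (hc : c + 1 < k), E ⟨c, by omega⟩ = F ⟨c + 1, hc⟩) (a : Fin k) :
    ∑ c with a < c, (E c - F c) = E ⟨k - 1, by have := a.2; omega⟩ - E a := by
  have hk : k - 1 < k := by have := a.2; omega
  have split : ∀ b : Fin k, (∑ c, (E c - F c)) =
      (∑ c with c < b, (E c - F c)) + (E b - F b) + ∑ c with b < c, (E c - F c) := by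
    intro b
    rw [← Finset.sum_filter_add_sum_filter_not Finset.univ (fun c => c < b), add_assoc]
    congr 1
    have : Finset.univ.filter (fun c => ¬c < b) =
        insert b (Finset.univ.filter fun c => b < c) := by
      ext c
      simp only [Finset.mem_filter, Finset.mem_univ, true_and, Finset.mem_insert]
      omega
    rw [this, Finset.sum_insert (by simp)]
  have h1 := split a
  have h2 := split ⟨k - 1, hk⟩
  have h3 : ∑ c with (⟨k - 1, hk⟩ : Fin k) < c, (E c - F c) = 0 := by
    refine Finset.sum_eq_zero fun c hc => ?_
    have := (Finset.mem_filter.1 hc).2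
    have := c.2
    rw [Fin.lt_def] at *
    dsimp at *
    omega
  rw [h3, Fin.sum_lt_telescope h] at h2
  rw [h2, Fin.sum_lt_telescope h a.1 a.2] at h1
  have h4 : ∑ c with a < c, (E c - F c) =
      (F ⟨k - 1, hk⟩ - F ⟨0, by omega⟩ + (E ⟨k - 1, hk⟩ - F ⟨k - 1, hk⟩) + 0) -
        (F a - F ⟨0, by omega⟩ + (E a - F a)) := by
    rw [h1]; simp
  rw [h4]
  abel

/-! ### Angles of initial and final parts of a chain -/

namespace Chain

variable {k : ℕ}

/-- The point with parameter `s` on the line that contains the `i`-th arm. -/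
def point (C : Chain k) (i : Fin k) (s : ℝ) : Plane := C.pt i.castSucc + s • C.dir i

/-- The parameter of the beginning of the `i`-th arm. -/
def lo (i : Fin k) : Option ℝ := if 0 < (i : ℕ) then some 0 else none

/-- The parameter of the end of the `i`-th arm. -/
def hi (i : Fin k) : Option ℝ := if (i : ℕ) + 1 < k then some 1 else none

/-- The parameters of the points of the `i`-th arm. -/
def InDomain (i : Fin k) (s : ℝ) : Prop :=
  (0 < (i : ℕ) → 0 ≤ s) ∧ ((i : ℕ) + 1 < k → s ≤ 1)

theorem point_mem_arm {C : Chain k} {i : Fin k} {s : ℝ} : C.point i s ∈ C.arm i ↔ InDomain i s :=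
  add_smul_dir_mem_arm

theorem inDomain_iff {i : Fin k} {s : ℝ} :
    InDomain i s ↔ (∀ t ∈ lo i, t ≤ s) ∧ ∀ u ∈ hi i, s ≤ u := by
  unfold InDomain lo hi
  split_ifs <;> simp [*]

/-- `l` and `h` bound a part of the `i`-th arm that has an end. -/
structure IsPart (i : Fin k) (l h : Option ℝ) : Prop where
  ne : l ≠ none ∨ h ≠ none
  le : ∀ t ∈ l, ∀ u ∈ h, t ≤ u
  sub : ∀ s, (∀ t ∈ l, t ≤ s) → (∀ u ∈ h, s ≤ u) → InDomain i s

/-- For `k = 1` the only arm is a whole line, whose angle would not be continuous off it. -/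
theorem isPart_full {i : Fin k} (h : 2 ≤ k) : IsPart i (lo i) (hi i) := by
  refine ⟨?_, ?_, fun s h₁ h₂ => inDomain_iff.2 ⟨h₁, h₂⟩⟩
  · unfold lo hi
    have := i.2
    split_ifs
    · simp
    · simp
    · simp
    · omega
  · unfold lo hi
    split_ifs <;> simp

theorem isPart_lo {i : Fin k} {s : ℝ} (h : InDomain i s) : IsPart i (lo i) (some s) := by
  refine ⟨by simp, fun t ht u hu => ?_, fun u h₁ h₂ => inDomain_iff.2 ⟨h₁, fun v hv => ?_⟩⟩
  · obtain rfl := Option.mem_some_iff.1 hu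
    exact (inDomain_iff.1 h).1 t ht
  · exact (h₂ s rfl).trans ((inDomain_iff.1 h).2 v hv)

theorem isPart_hi {i : Fin k} {s : ℝ} (h : InDomain i s) : IsPart i (some s) (hi i) := by
  refine ⟨by simp, fun t ht u hu => ?_, fun u h₁ h₂ => inDomain_iff.2 ⟨fun v hv => ?_, h₂⟩⟩
  · obtain rfl := Option.mem_some_iff.1 ht
    exact (inDomain_iff.1 h).2 u hu
  · exact ((inDomain_iff.1 h).1 v hv).trans (h₁ s rfl)

/-- The angle under which a part of the `i`-th arm is seen. -/
def partAngle (C : Chain k) (i : Fin k) (l h : Option ℝ) : Plane → ℝ :=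
  pieceAngle (C.pt i.castSucc) (C.dir i) l h

theorem continuousAt_partAngle (C : Chain k) {i : Fin k} {l h : Option ℝ} (hp : IsPart i l h)
    {z : Plane} (hz : z ∉ C.arm i) : ContinuousAt (C.partAngle i l h) z :=
  continuousAt_pieceAngle (C.dir_ne_zero i) hp.ne hp.le fun s h₁ h₂ hzs =>
    hz (hzs ▸ point_mem_arm.2 (hp.sub s h₁ h₂))

/-- The angle under which the chain is seen up to the point with parameter `s` on the `a`-th arm. -/
def prefixAngle (C : Chain k) (a : Fin k) (s : ℝ) (z : Plane) : ℝ :=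
  (∑ c with c < a, C.partAngle c (lo c) (hi c) z) + C.partAngle a (lo a) (some s) z

/-- The angle under which the chain is seen from the point with parameter `s` on the `a`-th arm. -/
def suffixAngle (C : Chain k) (a : Fin k) (s : ℝ) (z : Plane) : ℝ :=
  (∑ c with a < c, C.partAngle c (lo c) (hi c) z) + C.partAngle a (some s) (hi a) z

theorem two_le_of_lt {a c : Fin k} (h : c < a) : 2 ≤ k := by
  have := a.2
  rw [Fin.lt_def] at h
  omega

theorem notMem_arm {C : Chain k} {z : Plane} (hz : z ∉ C.carrier) (i : Fin k) : z ∉ C.arm i :=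
  fun h => hz (mem_iUnion.2 ⟨i, h⟩)

theorem continuousAt_prefixAngle (C : Chain k) {a : Fin k} {s : ℝ} (hs : InDomain a s)
    {z : Plane} (hz : z ∉ C.carrier) : ContinuousAt (C.prefixAngle a s) z := by
  refine ContinuousAt.add (tendsto_finsetSum _ fun c hc => ?_)
    (C.continuousAt_partAngle (isPart_lo hs) (notMem_arm hz a))
  exact C.continuousAt_partAngle (isPart_full (two_le_of_lt (Finset.mem_filter.1 hc).2))
    (notMem_arm hz c)

theorem continuousAt_suffixAngle (C : Chain k) {a : Fin k} {s : ℝ} (hs : InDomain a s)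
    {z : Plane} (hz : z ∉ C.carrier) : ContinuousAt (C.suffixAngle a s) z := by
  refine ContinuousAt.add (tendsto_finsetSum _ fun c hc => ?_)
    (C.continuousAt_partAngle (isPart_hi hs) (notMem_arm hz a))
  exact C.continuousAt_partAngle (isPart_full (two_le_of_lt (Finset.mem_filter.1 hc).2))
    (notMem_arm hz c)

theorem coe_partAngle (C : Chain k) {i : Fin k} {l h : Option ℝ} (hp : IsPart i l h)
    {z : Plane} (hz : z ∉ C.arm i) : (C.partAngle i l h z : Real.Angle) =
      ((toward (endNode (C.pt i.castSucc) (C.dir i) h) z).arg : Real.Angle) -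
        (toward (startNode (C.pt i.castSucc) (C.dir i) l) z).arg :=
  coe_pieceAngle (C.dir_ne_zero i) hp.le fun s h₁ h₂ hzs =>
    hz (hzs ▸ point_mem_arm.2 (hp.sub s h₁ h₂))

/-- Consecutive arms share a bend; this makes the angles of the arms telescope modulo 2π. -/
theorem endNode_hi (C : Chain k) (c : ℕ) (hc : c + 1 < k) :
    endNode (C.pt (⟨c, by omega⟩ : Fin k).castSucc) (C.dir ⟨c, by omega⟩) (hi (⟨c, by omega⟩ : Fin k)) =
      startNode (C.pt (⟨c + 1, hc⟩ : Fin k).castSucc) (C.dir ⟨c + 1, hc⟩) (lo (⟨c + 1, hc⟩ : Fin k)) := by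
  simp [endNode, startNode, hi, lo, hc, dir]

/-- The contributions of the bends telescope. Only the direction to the last point depends on `z`,
and `coe_suffixAngle` contains it with the opposite sign. -/
theorem coe_prefixAngle (C : Chain k) {a : Fin k} {s : ℝ} (hs : InDomain a s)
    {z : Plane} (hz : z ∉ C.carrier) : (C.prefixAngle a s z : Real.Angle) =
      ((toward (C.point a s, 1) z).arg : Real.Angle) -
        (planeToComplex (-C.dir ⟨0, by have := a.2; omega⟩)).arg := by
  rw [prefixAngle, Real.Angle.coe_add, ← Real.Angle.coe_coeHom, map_sum]
  simp only [Real.Angle.coe_coeHom]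
  rw [Finset.sum_congr rfl fun c hc => C.coe_partAngle
    (isPart_full (two_le_of_lt (Finset.mem_filter.1 hc).2)) (notMem_arm hz c),
    C.coe_partAngle (isPart_lo hs) (notMem_arm hz a),
    Fin.sum_lt_telescope (fun c hc => by rw [C.endNode_hi c hc]) a.1 a.2]
  have h1 : (toward (startNode (C.pt (⟨0, by have := a.2; omega⟩ : Fin k).castSucc)
      (C.dir ⟨0, by have := a.2; omega⟩) (lo (⟨0, by have := a.2; omega⟩ : Fin k))) z) =
      planeToComplex (-C.dir ⟨0, by have := a.2; omega⟩) := by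
    simp [toward, startNode, lo]
  rw [h1]
  simp only [endNode, Option.elim, point]
  abel

theorem coe_suffixAngle (C : Chain k) {a : Fin k} {s : ℝ} (hs : InDomain a s)
    {z : Plane} (hz : z ∉ C.carrier) : (C.suffixAngle a s z : Real.Angle) =
      ((planeToComplex (C.dir ⟨k - 1, by have := a.2; omega⟩)).arg : Real.Angle) -
        (toward (C.point a s, 1) z).arg := by
  rw [suffixAngle, Real.Angle.coe_add, ← Real.Angle.coe_coeHom, map_sum]
  simp only [Real.Angle.coe_coeHom]
  rw [Finset.sum_congr rfl fun c hc => C.coe_partAngle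
    (isPart_full (two_le_of_lt (Finset.mem_filter.1 hc).2)) (notMem_arm hz c),
    C.coe_partAngle (isPart_hi hs) (notMem_arm hz a),
    Fin.sum_gt_telescope (fun c hc => by rw [C.endNode_hi c hc]) a]
  have h0 : ¬(k - 1 + 1 < k) := by omega
  have h1 : (toward (endNode (C.pt (⟨k - 1, by have := a.2; omega⟩ : Fin k).castSucc)
      (C.dir ⟨k - 1, by have := a.2; omega⟩) (hi (⟨k - 1, by have := a.2; omega⟩ : Fin k))) z) =
      planeToComplex (C.dir ⟨k - 1, by have := a.2; omega⟩) := by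
    simp [toward, endNode, hi, h0]
  rw [h1]
  simp only [startNode, Option.elim, point]
  abel

/-- Following `C` up to a common point of `C` and `D`, and `D` from there on, we get a curve from
infinity to infinity that separates the plane. -/
theorem indicator_pathAngle_mem_locConst {C D : Chain k} {S : Set Plane} (hS : IsClosed S)
    (hC : C.carrier ⊆ S) (hD : D.carrier ⊆ S) {a b : Fin k} {s t : ℝ} (hs : InDomain a s)
    (ht : InDomain b t) (h : C.point a s = D.point b t) :
    Sᶜ.indicator (fun z => C.prefixAngle a s z + D.suffixAngle b t z) ∈ locConst S := by
  refine indicator_mem_locConst_of_angle hS (fun z hz => ?_)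
    (θ := (planeToComplex (D.dir ⟨k - 1, by have := a.2; omega⟩)).arg -
      (planeToComplex (-C.dir ⟨0, by have := a.2; omega⟩)).arg) (fun z hz => ?_)
  · exact (C.continuousAt_prefixAngle hs fun h => hz (hC h)).add
      (D.continuousAt_suffixAngle ht fun h => hz (hD h))
  · rw [Real.Angle.coe_add, coe_prefixAngle C hs fun h => hz (hC h),
      coe_suffixAngle D ht fun h => hz (hD h), h]
    abel

end Chain

namespace Chain

variable {k : ℕ}

theorem point_injective (C : Chain k) (i : Fin k) : Function.Injective (C.point i) :=
  C.add_smul_dir_injective i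

theorem exists_point_of_mem_arm {C : Chain k} {i : Fin k} {x : Plane} (hx : x ∈ C.arm i) :
    ∃ s, InDomain i s ∧ C.point i s = x := mem_arm.1 hx

/-- The jump of a part of an arm at a point of this arm. -/
theorem hasJump_partAngle_of_mem (C : Chain k) {i : Fin k} (hd : C.dir i 0 ≠ 0) {l h : Option ℝ}
    (hp : IsPart i l h) {s : ℝ} (hl : ∀ t ∈ l, t < s) (hh : ∀ u ∈ h, s < u) :
    HasJump (C.partAngle i l h) (C.point i s) (2 * Real.pi * SignType.sign (C.dir i 0)) :=
  hasJump_pieceAngle hd hp.ne hl hh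

theorem hasJump_partAngle_of_not (C : Chain k) {i : Fin k} {l h : Option ℝ}
    (hp : IsPart i l h) {s : ℝ} (hs : ¬((∀ t ∈ l, t ≤ s) ∧ ∀ u ∈ h, s ≤ u)) :
    HasJump (C.partAngle i l h) (C.point i s) 0 := by
  refine HasJump.of_continuousAt (continuousAt_pieceAngle (C.dir_ne_zero i) hp.ne hp.le ?_)
  intro u h₁ h₂ he
  obtain rfl := C.point_injective i he
  exact hs ⟨h₁, h₂⟩

theorem hasJump_partAngle_of_notMem (C : Chain k) {i : Fin k} {l h : Option ℝ}
    (hp : IsPart i l h) {p : Plane} (hz : p ∉ C.arm i) : HasJump (C.partAngle i l h) p 0 :=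
  HasJump.of_continuousAt (C.continuousAt_partAngle hp hz)

end Chain

open Chain

/-! ### Jumps along an arm of chains in general position -/

/-- Chains in general position: no arm is vertical, no two arms are parallel, and no three arms have
a common point. -/
structure InGeneralPosition {k n : ℕ} (C : Fin n → Chain k) : Prop where
  dir_ne : ∀ i a, (C i).dir a 0 ≠ 0
  cross_ne : ∀ α β : Fin n × Fin k, α ≠ β →
    (C α.1).dir α.2 0 * (C β.1).dir β.2 1 - (C α.1).dir α.2 1 * (C β.1).dir β.2 0 ≠ 0
  triple : ∀ α β γ : Fin n × Fin k, α ≠ β → α ≠ γ → β ≠ γ → ∀ x, x ∈ (C α.1).arm α.2 →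
    x ∈ (C β.1).arm β.2 → x ∉ (C γ.1).arm γ.2

namespace InGeneralPosition

variable {k n : ℕ} {C : Fin n → Chain k} (hC : InGeneralPosition C)
include hC

theorem subsingleton_params {α β : Fin n × Fin k} (h : α ≠ β) :
    {s | (C α.1).point α.2 s ∈ (C β.1).arm β.2}.Subsingleton := by
  intro s hs s' hs'
  obtain ⟨u, -, hu⟩ := exists_point_of_mem_arm hs
  obtain ⟨u', -, hu'⟩ := exists_point_of_mem_arm hs'
  have h1 : (s - s') • (C α.1).dir α.2 = (u - u') • (C β.1).dir β.2 := by
    simp only [point] at hu hu'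
    have h := congrArg₂ (fun x y : Plane => x - y) hu.symm hu'.symm
    rwa [add_sub_add_left_eq_sub, add_sub_add_left_eq_sub, ← sub_smul, ← sub_smul] at h
  have e0 := congrFun (congrArg (fun z : Plane => (z : Fin 2 → ℝ)) h1) 0
  have e1 := congrFun (congrArg (fun z : Plane => (z : Fin 2 → ℝ)) h1) 1
  simp at e0 e1
  have h2 : (s - s') * ((C α.1).dir α.2 0 * (C β.1).dir β.2 1 -
      (C α.1).dir α.2 1 * (C β.1).dir β.2 0) = 0 := by
    linear_combination (C β.1).dir β.2 1 * e0 - (C β.1).dir β.2 0 * e1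
  exact sub_eq_zero.1 ((mul_eq_zero.1 h2).resolve_right (hC.cross_ne α β h))

theorem eventually_notMem_arm {α β : Fin n × Fin k} (h : α ≠ β) (s₀ : ℝ) :
    ∀ᶠ s in 𝓝[≠] s₀, (C α.1).point α.2 s ∉ (C β.1).arm β.2 := by
  have hfin := ((hC.subsingleton_params h).finite.subset (sdiff_subset (t := {s₀}))).isClosed
  have : s₀ ∈ ({s | (C α.1).point α.2 s ∈ (C β.1).arm β.2} \ {s₀})ᶜ := by simp
  filter_upwards [mem_nhdsWithin_of_mem_nhds (hfin.isOpen_compl.mem_nhds this),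
    self_mem_nhdsWithin] with s hs hs' hmem
  exact hs ⟨hmem, hs'⟩

theorem exists_param_notMem (α : Fin n × Fin k) (m : ℝ) :
    ∃ s > m, ∀ β, β ≠ α → (C α.1).point α.2 s ∉ (C β.1).arm β.2 := by
  have hfin : (⋃ β : {β // β ≠ α}, {s | (C α.1).point α.2 s ∈ (C β.1.1).arm β.1.2}).Finite :=
    Set.finite_iUnion fun β => (hC.subsingleton_params (Ne.symm β.2)).finite
  obtain ⟨s, hs, hs'⟩ := ((Ioi_infinite m).sdiff hfin).nonempty
  exact ⟨s, hs, fun β hβ hmem => hs' (mem_iUnion.2 ⟨⟨β, hβ⟩, hmem⟩)⟩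

/-- Two pairs of arms that have the same common point are the same. -/
theorem eq_of_mem {α β α' β' : Fin n × Fin k} (h : α ≠ β) (h' : α' ≠ β') {x : Plane}
    (h1 : x ∈ (C α.1).arm α.2) (h2 : x ∈ (C β.1).arm β.2) (h3 : x ∈ (C α'.1).arm α'.2)
    (h4 : x ∈ (C β'.1).arm β'.2) : (α = α' ∧ β = β') ∨ (α = β' ∧ β = α') := by
  have key : ∀ γ : Fin n × Fin k, x ∈ (C γ.1).arm γ.2 → γ = α ∨ γ = β := by
    intro γ hγ
    by_contra! hcon
    exact hC.triple α β γ h hcon.1.symm hcon.2.symm x h1 h2 hγ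
  rcases key α' h3 with rfl | rfl <;> rcases key β' h4 with rfl | rfl <;> simp_all

/-- A part of an arm jumps by the same amount before and after a given point of an arm. -/
theorem exists_jump_partAngle (α : Fin n × Fin k) (s₀ : ℝ) (β : Fin n × Fin k) {l h : Option ℝ}
    (hp : IsPart β.2 l h) (hs : α = β → s₀ ∉ l ∧ s₀ ∉ h) :
    ∃ J, ∀ᶠ s in 𝓝[≠] s₀, HasJump ((C β.1).partAngle β.2 l h) ((C α.1).point α.2 s) J := by
  by_cases hαβ : α = β
  swap
  · exact ⟨0, (hC.eventually_notMem_arm hαβ s₀).mono fun s hs =>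
      (C β.1).hasJump_partAngle_of_notMem hp hs⟩
  subst hαβ
  obtain ⟨hl, hh⟩ := hs rfl
  by_cases hin : (∀ t ∈ l, t < s₀) ∧ ∀ u ∈ h, s₀ < u
  · refine ⟨2 * Real.pi * SignType.sign ((C α.1).dir α.2 0), ?_⟩
    have h1 : ∀ᶠ s in 𝓝 s₀, ∀ t ∈ l, t < s := by
      rcases l with _ | t
      · simp
      · filter_upwards [lt_mem_nhds (hin.1 t rfl)] with s hs
        simpa using hs
    have h2 : ∀ᶠ s in 𝓝 s₀, ∀ u ∈ h, s < u := by
      rcases h with _ | u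
      · simp
      · filter_upwards [gt_mem_nhds (hin.2 u rfl)] with s hs
        simpa using hs
    filter_upwards [mem_nhdsWithin_of_mem_nhds h1, mem_nhdsWithin_of_mem_nhds h2] with s h1 h2
    exact (C α.1).hasJump_partAngle_of_mem (hC.dir_ne _ _) hp h1 h2
  · refine ⟨0, ?_⟩
    rw [not_and_or] at hin
    push Not at hin
    rcases hin with ⟨t, ht, hle⟩ | ⟨t, ht, hle⟩
    · have hlt : s₀ < t := lt_of_le_of_ne hle fun h => hl (h ▸ ht)
      filter_upwards [mem_nhdsWithin_of_mem_nhds (gt_mem_nhds hlt)] with s hs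
      exact (C α.1).hasJump_partAngle_of_not hp fun h => (h.1 t ht).not_gt hs
    · have hlt : t < s₀ := lt_of_le_of_ne hle fun he => hh (he ▸ ht)
      filter_upwards [mem_nhdsWithin_of_mem_nhds (lt_mem_nhds hlt)] with s hs
      exact (C α.1).hasJump_partAngle_of_not hp fun h => (h.2 t ht).not_gt hs

theorem exists_jump_sum (α : Fin n × Fin k) {s₀ : ℝ} (hs₀ : s₀ ∉ lo α.2 ∧ s₀ ∉ hi α.2)
    (i : Fin n) (t : Finset (Fin k)) (ht : t.Nonempty → 2 ≤ k) :
    ∃ J, ∀ᶠ s in 𝓝[≠] s₀, HasJump (fun z => ∑ c ∈ t, (C i).partAngle c (lo c) (hi c) z)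
      ((C α.1).point α.2 s) J := by
  have h1 : ∀ c ∈ t, ∃ J, ∀ᶠ s in 𝓝[≠] s₀,
      HasJump ((C i).partAngle c (lo c) (hi c)) ((C α.1).point α.2 s) J := fun c hc =>
    hC.exists_jump_partAngle α s₀ (i, c) (isPart_full (ht ⟨c, hc⟩)) (by rintro rfl; exact hs₀)
  choose! J hJ using h1
  refine ⟨∑ c ∈ t, J c, ?_⟩
  filter_upwards [(t.eventually_all).2 hJ] with s hs
  exact HasJump.sum hs

/-- Arms other than `α` are missed near `s₀`, except perhaps at `s₀` itself. The contribution of `α`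
can change only at its ends, excluded by `hs₀`, or where the prefix stops, excluded by `hne`. -/
theorem exists_jump_prefixAngle (α : Fin n × Fin k) {s₀ : ℝ}
    (hs₀ : s₀ ∉ lo α.2 ∧ s₀ ∉ hi α.2) (β : Fin n × Fin k) {t : ℝ} (ht : InDomain β.2 t)
    (hne : α = β → s₀ ≠ t) :
    ∃ J, ∀ᶠ s in 𝓝[≠] s₀, HasJump ((C β.1).prefixAngle β.2 t) ((C α.1).point α.2 s) J := by
  obtain ⟨J, hJ⟩ := hC.exists_jump_sum α hs₀ β.1 (Finset.univ.filter fun c => c < β.2)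
    (fun ⟨c, hc⟩ => two_le_of_lt (Finset.mem_filter.1 hc).2)
  obtain ⟨K, hK⟩ := hC.exists_jump_partAngle α s₀ β (isPart_lo ht) (by
    rintro rfl
    exact ⟨hs₀.1, by simpa using (hne rfl).symm⟩)
  exact ⟨J + K, by filter_upwards [hJ, hK] with s h1 h2 using h1.add h2⟩

theorem exists_jump_suffixAngle (α : Fin n × Fin k) {s₀ : ℝ}
    (hs₀ : s₀ ∉ lo α.2 ∧ s₀ ∉ hi α.2) (β : Fin n × Fin k) {t : ℝ} (ht : InDomain β.2 t)
    (hne : α = β → s₀ ≠ t) :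
    ∃ J, ∀ᶠ s in 𝓝[≠] s₀, HasJump ((C β.1).suffixAngle β.2 t) ((C α.1).point α.2 s) J := by
  obtain ⟨J, hJ⟩ := hC.exists_jump_sum α hs₀ β.1 (Finset.univ.filter fun c => β.2 < c)
    (fun ⟨c, hc⟩ => two_le_of_lt (Finset.mem_filter.1 hc).2)
  obtain ⟨K, hK⟩ := hC.exists_jump_partAngle α s₀ β (isPart_hi ht) (by
    rintro rfl
    exact ⟨by simpa using (hne rfl).symm, hs₀.2⟩)
  exact ⟨J + K, by filter_upwards [hJ, hK] with s h1 h2 using h1.add h2⟩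

/-- Where the `α`-th arm ends the first part of a path, the jump of the path across this arm
changes. -/
theorem exists_jump_prefixAngle_self (α : Fin n × Fin k) {s₀ : ℝ}
    (hs₀ : s₀ ∉ lo α.2 ∧ s₀ ∉ hi α.2) (ht : InDomain α.2 s₀) :
    ∃ J, (∀ᶠ s in 𝓝[>] s₀, HasJump ((C α.1).prefixAngle α.2 s₀) ((C α.1).point α.2 s) J) ∧
      ∀ᶠ s in 𝓝[<] s₀, HasJump ((C α.1).prefixAngle α.2 s₀) ((C α.1).point α.2 s)
        (J + 2 * Real.pi * SignType.sign ((C α.1).dir α.2 0)) := by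
  obtain ⟨J, hJ⟩ := hC.exists_jump_sum α hs₀ α.1 (Finset.univ.filter fun c => c < α.2)
    (fun ⟨c, hc⟩ => two_le_of_lt (Finset.mem_filter.1 hc).2)
  refine ⟨J, ?_, ?_⟩
  -- Beyond `s₀` the point is off the final piece of the prefix, which stops at `s₀`.
  · filter_upwards [nhdsWithin_mono _ (fun x hx => ne_of_gt hx) hJ, self_mem_nhdsWithin]
      with s h1 h2
    have h3 := (C α.1).hasJump_partAngle_of_not (isPart_lo ht) (s := s)
      fun h => (h.2 s₀ rfl).not_gt h2
    have h4 := h1.add h3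
    rwa [add_zero] at h4
  -- Just before `s₀` the point is inside the final piece, which contributes its full jump.
  · have h1 : ∀ᶠ s in 𝓝 s₀, ∀ t ∈ lo α.2, t < s := by
      have h2 : ∀ t ∈ lo α.2, t < s₀ := fun t h =>
        lt_of_le_of_ne ((inDomain_iff.1 ht).1 t h) fun he => hs₀.1 (he ▸ h)
      generalize lo α.2 = l at h2
      rcases l with _ | t
      · simp
      · filter_upwards [lt_mem_nhds (h2 t rfl)] with s hs
        simpa using hs
    filter_upwards [nhdsWithin_mono _ (fun x hx => ne_of_lt hx) hJ, self_mem_nhdsWithin,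
      mem_nhdsWithin_of_mem_nhds h1] with s h1 h2 h3
    exact h1.add ((C α.1).hasJump_partAngle_of_mem (hC.dir_ne _ _) (isPart_lo ht) h3
      (by simpa using h2))

/-- Near a point that lies on no other arm, a small vertical move leaves all chains, because the arm
is not vertical. -/
theorem hasJump_zero {F : Plane → ℝ} (hF : ∀ z ∉ ⋃ i, (C i).carrier, F z = 0)
    {α : Fin n × Fin k} {s : ℝ}
    (hs : ∀ β, β ≠ α → (C α.1).point α.2 s ∉ (C β.1).arm β.2) :
    HasJump F ((C α.1).point α.2 s) 0 := by
  have hcl : IsClosed (⋃ β : {β // β ≠ α}, (C β.1.1).arm β.1.2) :=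
    isClosed_iUnion_of_finite fun β => Chain.isClosed_arm _ _
  have hp : (C α.1).point α.2 s ∈ (⋃ β : {β // β ≠ α}, (C β.1.1).arm β.1.2)ᶜ := by
    intro h
    obtain ⟨β, hβ⟩ := mem_iUnion.1 h
    exact hs β.1 β.2 hβ
  have hoff : ∀ᶠ z in 𝓝 ((C α.1).point α.2 s), ∀ β, β ≠ α → z ∉ (C β.1).arm β.2 := by
    filter_upwards [hcl.isOpen_compl.mem_nhds hp] with z hz β hβ hmem
    exact hz (mem_iUnion.2 ⟨⟨β, hβ⟩, hmem⟩)
  have hself : ∀ t : ℝ, t ≠ 0 → (C α.1).point α.2 s + t • vertVec ∉ (C α.1).arm α.2 := by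
    intro t ht hmem
    obtain ⟨u, -, hu⟩ := exists_point_of_mem_arm hmem
    have e0 := congrFun (congrArg (fun z : Plane => (z : Fin 2 → ℝ)) hu) 0
    have e1 := congrFun (congrArg (fun z : Plane => (z : Fin 2 → ℝ)) hu) 1
    simp [point, vertVec, hC.dir_ne] at e0 e1
    subst e0
    simp at e1
    exact ht e1
  have hz : ∀ z, (∀ β, β ≠ α → z ∉ (C β.1).arm β.2) → z ∉ (C α.1).arm α.2 → F z = 0 := by
    intro z h1 h2
    refine hF z fun h => ?_
    simp only [mem_iUnion, carrier] at h
    obtain ⟨i, a, h⟩ := h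
    by_cases he : (i, a) = α
    · subst he; exact h2 h
    · exact h1 (i, a) he h
  refine (tendsto_const_nhds (x := (0 : ℝ))).congr' ?_
  filter_upwards [(tendsto_add_smul_nhdsGT _ vertVec).eventually hoff,
    (tendsto_sub_smul_nhdsGT _ vertVec).eventually hoff, self_mem_nhdsWithin] with t h1 h2 h3
  rw [hz _ h1 (hself t (ne_of_gt h3)), hz _ h2, sub_zero]
  rw [sub_eq_add_neg, ← neg_smul]
  exact hself _ (neg_ne_zero.2 (ne_of_gt h3))

end InGeneralPosition

theorem coe_sign_ne_zero {x : ℝ} (hx : x ≠ 0) : ((SignType.sign x : SignType) : ℝ) ≠ 0 := by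
  rcases lt_or_gt_of_ne hx with h | h
  · simp [sign_neg h]
  · simp [sign_pos h]

/-! ### Counting the pairs of arms that can cross -/

/-- The pairs of arms that can cross in a family of chains. -/
abbrev ArmPair (n k : ℕ) : Type :=
  {y : (Fin n × Fin k) × (Fin n × Fin k) //
    y.1.1 < y.2.1 ∨ (y.1.1 = y.2.1 ∧ (y.1.2 : ℕ) + 1 < y.2.2)}

theorem card_fin_lt (n : ℕ) : Fintype.card {p : Fin n × Fin n // p.1 < p.2} = n.choose 2 := by
  rw [Fintype.card_subtype, Finset.card_filter, Fintype.sum_prod_type, Finset.sum_comm]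
  simp_rw [← Finset.card_filter]
  have : ∀ j : Fin n, (Finset.univ.filter fun i : Fin n => i < j).card = j := by
    intro j
    have : (Finset.univ.filter fun i : Fin n => i < j) = Finset.Iio j := by ext; simp
    rw [this, Fin.card_Iio]
  simp_rw [this]
  rw [Fin.sum_univ_eq_sum_range (fun i => i) n, Finset.sum_range_id, Nat.choose_two_right]

/-- Decreasing the second index by one turns these pairs into ordinary increasing pairs in `Fin (k -
1)`. -/
theorem card_fin_succ_lt (k : ℕ) :
    Fintype.card {p : Fin k × Fin k // (p.1 : ℕ) + 1 < p.2} = (k - 1).choose 2 := by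
  rw [← card_fin_lt]
  refine Fintype.card_congr
    ⟨fun p => ⟨(⟨p.1.1, ?_⟩, ⟨p.1.2 - 1, ?_⟩), ?_⟩,
      fun p => ⟨(⟨p.1.1, ?_⟩, ⟨p.1.2 + 1, ?_⟩), ?_⟩, fun p => ?_, fun p => ?_⟩
  · have := p.2; omega
  · have := p.2; omega
  · have := p.2; simp only [Fin.lt_def]; omega
  · omega
  · omega
  · have := p.2; simp only [Fin.lt_def] at this ⊢; omega
  · obtain ⟨⟨a, b⟩, h⟩ := p
    have h' : (a : ℕ) + 1 < b := h
    simp only [Subtype.mk.injEq, Prod.mk.injEq, Fin.ext_iff, true_and]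
    omega
  · obtain ⟨⟨a, b⟩, h⟩ := p
    simp

theorem card_armPair (n k : ℕ) :
    Fintype.card (ArmPair n k) = n * (k - 1).choose 2 + n.choose 2 * k ^ 2 := by
  have e : ArmPair n k ≃ (Fin n × {p : Fin k × Fin k // (p.1 : ℕ) + 1 < p.2}) ⊕
      ({p : Fin n × Fin n // p.1 < p.2} × (Fin k × Fin k)) :=
    { toFun := fun y => if h : y.1.1.1 < y.1.2.1
        then Sum.inr (⟨(y.1.1.1, y.1.2.1), h⟩, (y.1.1.2, y.1.2.2))
        else Sum.inl (y.1.1.1, ⟨(y.1.1.2, y.1.2.2), (y.2.resolve_left h).2⟩)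
      invFun := Sum.elim (fun q => ⟨((q.1, q.2.1.1), (q.1, q.2.1.2)), Or.inr ⟨rfl, q.2.2⟩⟩)
        (fun q => ⟨((q.1.1.1, q.2.1), (q.1.1.2, q.2.2)), Or.inl q.1.2⟩)
      left_inv := by
        rintro ⟨⟨⟨i, a⟩, ⟨j, b⟩⟩, h⟩
        by_cases h' : i < j
        · simp [h']
        · have hij : i = j := (h.resolve_left h').1
          subst hij
          simp
      right_inv := by
        rintro (⟨i, ⟨⟨a, b⟩, h⟩⟩ | ⟨⟨⟨i, j⟩, h⟩, ⟨a, b⟩⟩)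
        · simp
        · have h' : i < j := h
          simp [h'] }
  rw [Fintype.card_congr e]
  simp only [Fintype.card_sum, Fintype.card_prod, card_fin_succ_lt, card_fin_lt, Fintype.card_fin]
  ring

theorem ArmPair.ne {n k : ℕ} (y : ArmPair n k) : y.1.1 ≠ y.1.2 := by
  intro h
  have := y.2
  rw [h] at this
  simp at this

/-- The defining condition orders the pair, so no pair is the reverse of another. -/
theorem ArmPair.eq_of_swap {n k : ℕ} {y y' : ArmPair n k} (h₁ : y.1.1 = y'.1.2)
    (h₂ : y.1.2 = y'.1.1) : y = y' := by
  have h := y.2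
  have h' := y'.2
  rw [h₁, h₂] at h
  rcases h with h | h <;> rcases h' with h' | h' <;> omega

/-! ### Independence of the path angles and the lower bound -/

/-- Along the curve `u`, the jump of `f` is eventually constant. -/
def StableJump (u : ℝ → Plane) (l : Filter ℝ) (f : Plane → ℝ) : Prop :=
  ∃ J, ∀ᶠ s in l, HasJump f (u s) J

namespace StableJump

variable {u : ℝ → Plane} {l : Filter ℝ} {f g : Plane → ℝ}

theorem add (hf : StableJump u l f) (hg : StableJump u l g) :
    StableJump u l (fun z => f z + g z) := by
  obtain ⟨J, hJ⟩ := hf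
  obtain ⟨K, hK⟩ := hg
  exact ⟨J + K, by filter_upwards [hJ, hK] with s h1 h2 using h1.add h2⟩

theorem const_mul (c : ℝ) (hf : StableJump u l f) : StableJump u l (fun z => c * f z) := by
  obtain ⟨J, hJ⟩ := hf
  exact ⟨c * J, by filter_upwards [hJ] with s h1 using h1.const_mul c⟩

theorem sum {ι : Type*} {t : Finset ι} {f : ι → Plane → ℝ} (hf : ∀ i ∈ t, StableJump u l (f i)) :
    StableJump u l (fun z => ∑ i ∈ t, f i z) := by
  choose! J hJ using hf
  refine ⟨∑ c ∈ t, J c, ?_⟩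
  filter_upwards [(t.eventually_all).2 hJ] with s hs
  exact HasJump.sum hs

theorem const (c : ℝ) : StableJump u l (fun _ => c) :=
  ⟨0, Eventually.of_forall fun _ => HasJump.of_continuousAt continuousAt_const⟩

end StableJump

namespace InGeneralPosition

variable {k n : ℕ} {C : Fin n → Chain k}

/-- The angle under which the path is seen that follows a chain up to a point of the `α`-th arm, and
then leaves along the chain of the `β`-th arm. -/
def pathAngle (C : Fin n → Chain k) (α β : Fin n × Fin k) (s t : ℝ) (z : Plane) : ℝ :=
  (C α.1).prefixAngle α.2 s z + (C β.1).suffixAngle β.2 t z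

theorem hasJump_sum_part (i : Fin n) (t : Finset (Fin k)) (ht : t.Nonempty → 2 ≤ k) {p : Plane}
    (hp : ∀ c ∈ t, p ∉ (C i).arm c) :
    HasJump (fun z => ∑ c ∈ t, (C i).partAngle c (lo c) (hi c) z) p 0 := by
  have := HasJump.sum (t := t) (f := fun c => (C i).partAngle c (lo c) (hi c)) (J := fun _ => 0)
    (p := p) fun c hc => (C i).hasJump_partAngle_of_notMem (isPart_full (ht ⟨c, hc⟩)) (hp c hc)
  simpa using this

theorem hasJump_pathAngle_of_notMem {α : Fin n × Fin k} {s : ℝ} (hs : InDomain α.2 s) {p : Plane}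
    (hp : ∀ c, p ∉ (C α.1).arm c) : HasJump (pathAngle C α α s s) p 0 := by
  have h : p ∉ (C α.1).carrier := by simpa [carrier] using hp
  exact HasJump.of_continuousAt (((C α.1).continuousAt_prefixAngle hs h).add
    ((C α.1).continuousAt_suffixAngle hs h))

theorem hasJump_pathAngle_self (hC : InGeneralPosition C) {α : Fin n × Fin k} {s t : ℝ}
    (hs : InDomain α.2 s) (ht : ∀ u ∈ hi α.2, t < u) (hst : s < t)
    (hp : ∀ c ≠ α.2, (C α.1).point α.2 t ∉ (C α.1).arm c) :
    HasJump (pathAngle C α α s s) ((C α.1).point α.2 t)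
      (2 * Real.pi * SignType.sign ((C α.1).dir α.2 0)) := by
  have h1 := hasJump_sum_part α.1 (Finset.univ.filter fun c => c < α.2)
    (fun ⟨c, hc⟩ => two_le_of_lt (Finset.mem_filter.1 hc).2) (p := (C α.1).point α.2 t)
    (fun c hc => hp c (ne_of_lt (Finset.mem_filter.1 hc).2))
  have h2 := hasJump_sum_part α.1 (Finset.univ.filter fun c => α.2 < c)
    (fun ⟨c, hc⟩ => two_le_of_lt (Finset.mem_filter.1 hc).2) (p := (C α.1).point α.2 t)
    (fun c hc => hp c (ne_of_gt (Finset.mem_filter.1 hc).2))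
  have h3 := (C α.1).hasJump_partAngle_of_not (isPart_lo hs) (s := t)
    fun h => (h.2 s rfl).not_gt hst
  have h4 := (C α.1).hasJump_partAngle_of_mem (hC.dir_ne _ _) (isPart_hi hs) (s := t)
    (by simpa using hst) ht
  have h5 := (h1.add h3).add (h2.add h4)
  rw [zero_add, zero_add, zero_add] at h5
  exact h5

/-- Coefficients of crossings are killed by comparing jumps along the first arm before and after the
crossing, those of whole chains by the jump at `r' i`, and the constant by any point off the chains.
The chain itself is a path cut at the finite point `r i` of its last arm, so that even for `k = 1`
each piece has an end. -/
theorem linearIndependent_pathAngle (hC : InGeneralPosition C) {s t : ArmPair n k → ℝ}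
    (hs : ∀ y, InDomain y.1.1.2 (s y)) (hs' : ∀ y, s y ∉ lo y.1.1.2 ∧ s y ∉ hi y.1.1.2)
    (ht : ∀ y, InDomain y.1.2.2 (t y))
    (hst : ∀ y, (C y.1.1.1).point y.1.1.2 (s y) = (C y.1.2.1).point y.1.2.2 (t y))
    {b : Fin k} (hb : (b : ℕ) + 1 = k) {r r' : Fin n → ℝ} (hr : ∀ i, InDomain b (r i))
    (hrr' : ∀ i, r i < r' i)
    (hr0 : ∀ i β, β ≠ (i, b) → (C i).point b (r i) ∉ (C β.1).arm β.2)
    (hr1 : ∀ i β, β ≠ (i, b) → (C i).point b (r' i) ∉ (C β.1).arm β.2)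
    {c : ArmPair n k → ℝ} {e : Fin n → ℝ} {m : ℝ}
    (hF : ∀ z ∉ ⋃ i, (C i).carrier, (∑ y, c y * pathAngle C y.1.1 y.1.2 (s y) (t y) z) +
      ((∑ i, e i * pathAngle C (i, b) (i, b) (r i) (r i) z) + m) = 0) :
    c = 0 ∧ e = 0 ∧ m = 0 := by
  have hmem : ∀ y, (C y.1.1.1).point y.1.1.2 (s y) ∈ (C y.1.1.1).arm y.1.1.2 ∧
      (C y.1.1.1).point y.1.1.2 (s y) ∈ (C y.1.2.1).arm y.1.2.2 := fun y =>
    ⟨point_mem_arm.2 (hs y), hst y ▸ point_mem_arm.2 (ht y)⟩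
  have hc : c = 0 := by
    funext y₀
    set α := y₀.1.1 with hα
    set u := (C α.1).point α.2 with hu
    -- Without triple points different pairs cross at different points, so every other path switches
    -- elsewhere and its jump is stable here.
    have hpath : ∀ y ≠ y₀, StableJump u (𝓝[≠] (s y₀))
        (pathAngle C y.1.1 y.1.2 (s y) (t y)) := by
      intro y hy
      have hne : u (s y₀) ≠ (C y.1.1.1).point y.1.1.2 (s y) := by
        intro he
        rcases hC.eq_of_mem y.ne y₀.ne (hmem y).1 (hmem y).2 (he ▸ (hmem y₀).1)
          (he ▸ (hmem y₀).2) with h | h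
        · exact hy (Subtype.ext (Prod.ext h.1 h.2))
        · exact hy (ArmPair.eq_of_swap h.1 h.2)
      refine StableJump.add (hC.exists_jump_prefixAngle α (hs' y₀) _ (hs y) fun h he => ?_)
        (hC.exists_jump_suffixAngle α (hs' y₀) _ (ht y) fun h he => ?_)
      · exact hne (by rw [hu, h, he])
      · exact hne (by rw [hst, hu, h, he])
    have hsuf : StableJump u (𝓝[≠] (s y₀)) ((C y₀.1.2.1).suffixAngle y₀.1.2.2 (t y₀)) :=
      hC.exists_jump_suffixAngle α (hs' y₀) _ (ht y₀) fun h => (y₀.ne h).elim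
    have hw : ∀ i, StableJump u (𝓝[≠] (s y₀)) (pathAngle C (i, b) (i, b) (r i) (r i)) := by
      intro i
      have hne : α = (i, b) → s y₀ ≠ r i := by
        intro h he
        refine hr0 i y₀.1.2 (fun h' => y₀.ne (h.trans h'.symm)) ?_
        have h1 := (hmem y₀).2
        rw [← hα, h, he] at h1
        exact h1
      exact StableJump.add (hC.exists_jump_prefixAngle α (hs' y₀) _ (hr i) hne)
        (hC.exists_jump_suffixAngle α (hs' y₀) _ (hr i) hne)
    have hrest : StableJump u (𝓝[≠] (s y₀)) (fun z =>
        c y₀ * (C y₀.1.2.1).suffixAngle y₀.1.2.2 (t y₀) z +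
        ((∑ y ∈ Finset.univ.erase y₀, c y * pathAngle C y.1.1 y.1.2 (s y) (t y) z) +
        ((∑ i, e i * pathAngle C (i, b) (i, b) (r i) (r i) z) + m))) :=
      (hsuf.const_mul _).add ((StableJump.sum fun y hy =>
        (hpath y (Finset.ne_of_mem_erase hy)).const_mul _).add
        ((StableJump.sum fun i _ => (hw i).const_mul _).add (StableJump.const m)))
    obtain ⟨K, hK⟩ := hrest
    obtain ⟨J, hJ1, hJ2⟩ := hC.exists_jump_prefixAngle_self α (hs' y₀) (hs y₀)
    have hzero : ∀ᶠ v in 𝓝[≠] (s y₀), HasJump (fun z =>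
        c y₀ * (C α.1).prefixAngle α.2 (s y₀) z +
        (c y₀ * (C y₀.1.2.1).suffixAngle y₀.1.2.2 (t y₀) z +
        ((∑ y ∈ Finset.univ.erase y₀, c y * pathAngle C y.1.1 y.1.2 (s y) (t y) z) +
        ((∑ i, e i * pathAngle C (i, b) (i, b) (r i) (r i) z) + m)))) (u v) 0 := by
      have h1 : ∀ᶠ v in 𝓝[≠] (s y₀), ∀ β, β ≠ α → u v ∉ (C β.1).arm β.2 :=
        eventually_all.2 fun β => by
          by_cases h : β = α
          · simp [h]
          · exact (hC.eventually_notMem_arm (Ne.symm h) (s y₀)).mono fun _ h _ => h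
      filter_upwards [h1] with v hv
      refine hC.hasJump_zero (fun z hz => ?_) hv
      rw [← hF z hz, ← Finset.add_sum_erase _ _ (Finset.mem_univ y₀), pathAngle]
      ring
    -- The combination vanishes off the chains and hence has no jump. This gives one equation on
    -- each side of the crossing; they differ only by the jump of the prefix.
    have key : ∀ (l : Filter ℝ) [l.NeBot] (J' : ℝ), l ≤ 𝓝[≠] (s y₀) →
        (∀ᶠ v in l, HasJump ((C α.1).prefixAngle α.2 (s y₀)) (u v) J') → c y₀ * J' + K = 0 := by
      intro l _ J' hl hJ'
      obtain ⟨v, h1, h2, h3⟩ := (hJ'.and ((hK.filter_mono hl).and (hzero.filter_mono hl))).exists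
      exact ((h1.const_mul _).add h2).unique h3
    have k1 := key (𝓝[>] (s y₀)) J (nhdsWithin_mono _ fun x hx => ne_of_gt hx) hJ1
    have k2 := key (𝓝[<] (s y₀)) _ (nhdsWithin_mono _ fun x hx => ne_of_lt hx) hJ2
    have hsg : ((SignType.sign ((C α.1).dir α.2 0) : SignType) : ℝ) ≠ 0 :=
      coe_sign_ne_zero (hC.dir_ne α.1 α.2)
    have k3 : c y₀ * (2 * Real.pi * SignType.sign ((C α.1).dir α.2 0)) = 0 := by linarith
    exact (mul_eq_zero.1 k3).resolve_right (mul_ne_zero (by positivity) hsg)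
  have he : e = 0 := by
    funext i₀
    have h0 := hC.hasJump_zero hF (α := (i₀, b)) (hr1 i₀)
    have hhi : hi b = none := by simp [hi, hb]
    have h1 := hC.hasJump_pathAngle_self (α := (i₀, b)) (hr i₀) (t := r' i₀) (by simp [hhi])
      (hrr' i₀) fun a ha => hr1 i₀ (i₀, a) (by simpa using ha)
    have h2 : ∀ i ∈ Finset.univ.erase i₀, HasJump
        (fun z => e i * pathAngle C (i, b) (i, b) (r i) (r i) z) ((C i₀).point b (r' i₀)) 0 := by
      intro i hi
      have := (hasJump_pathAngle_of_notMem (α := (i, b)) (hr i)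
        (fun a => hr1 i₀ (i, a) (by simp [Finset.ne_of_mem_erase hi]))).const_mul (e i)
      rwa [mul_zero] at this
    have h3 := (h1.const_mul (e i₀)).add ((HasJump.sum h2).add
      (HasJump.of_continuousAt (continuousAt_const (y := m))))
    have h4 := h3.unique (K := 0) (by
      convert h0 using 2 with z
      rw [hc, ← Finset.add_sum_erase Finset.univ (fun i => e i * _) (Finset.mem_univ i₀)]
      simp only [Pi.zero_apply, zero_mul, Finset.sum_const_zero, zero_add, add_assoc])
    have hsg : ((SignType.sign ((C i₀).dir b 0) : SignType) : ℝ) ≠ 0 :=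
      coe_sign_ne_zero (hC.dir_ne i₀ b)
    have h5 : e i₀ * (2 * Real.pi * SignType.sign ((C i₀).dir b 0)) = 0 := by simpa using h4
    exact (mul_eq_zero.1 h5).resolve_right (mul_ne_zero (by positivity) hsg)
  refine ⟨hc, he, ?_⟩
  -- If the chains filled the plane, `hasJump_zero` would apply to every function, including a path
  -- angle with jump ±2π.
  have hne : (⋃ i, (C i).carrier)ᶜ.Nonempty := by
    by_contra h
    rw [not_nonempty_iff_eq_empty, compl_empty_iff] at h
    by_cases hn : IsEmpty (Fin n)
    · simp at h
      exact empty_ne_univ h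
    · rw [not_isEmpty_iff] at hn
      obtain ⟨i⟩ := hn
      have h3 := hC.hasJump_zero (F := (pathAngle C (i, b) (i, b) (r i) (r i)))
        (fun z hz => (hz (h ▸ mem_univ z)).elim) (α := (i, b)) (hr1 i)
      have hhi : hi b = none := by simp [hi, hb]
      have h4 := hC.hasJump_pathAngle_self (α := (i, b)) (hr i) (t := r' i) (by simp [hhi])
        (hrr' i) fun a ha => hr1 i (i, a) (by simpa using ha)
      have h5 := h3.unique h4
      have hsg : ((SignType.sign ((C i).dir b 0) : SignType) : ℝ) ≠ 0 :=
        coe_sign_ne_zero (hC.dir_ne i b)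
      exact mul_ne_zero (by positivity) hsg h5.symm
  obtain ⟨z, hz⟩ := hne
  have := hF z hz
  simpa [hc, he] using this

/-- Chains in general position, with all the crossings that are possible, form the maximum number of
regions. -/
theorem maxRegions_le (hC : InGeneralPosition C) (hk : 1 ≤ k)
    (hcross : ∀ y : ArmPair n k,
      ((C y.1.1.1).openArm y.1.1.2 ∩ (C y.1.2.1).openArm y.1.2.2).Nonempty) :
    maxRegions k n ≤ chainRegionCount C := by
  have hy : ∀ y : ArmPair n k, ∃ s t, InDomain y.1.1.2 s ∧ (s ∉ lo y.1.1.2 ∧ s ∉ hi y.1.1.2) ∧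
      InDomain y.1.2.2 t ∧
      (C y.1.1.1).point y.1.1.2 s = (C y.1.2.1).point y.1.2.2 t := by
    intro y
    obtain ⟨x, hx1, hx2⟩ := hcross y
    obtain ⟨s, hs, hsx⟩ := mem_openArm.1 hx1
    obtain ⟨t, ht, htx⟩ := mem_openArm.1 hx2
    refine ⟨s, t, ⟨fun h => (hs.1 h).le, fun h => (hs.2 h).le⟩, ⟨?_, ?_⟩,
      ⟨fun h => (ht.1 h).le, fun h => (ht.2 h).le⟩, hsx.trans htx.symm⟩
    · unfold lo
      split_ifs with h
      · simpa using (hs.1 h).ne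
      · simp
    · unfold hi
      split_ifs with h
      · simpa using (hs.2 h).ne'
      · simp
  choose s t hs hs' ht hst using hy
  let b : Fin k := ⟨k - 1, by omega⟩
  have hb : (b : ℕ) + 1 = k := by simp only [b]; omega
  -- `r i > 0` keeps the cut point on the last arm, which is unbounded above.
  choose r hr hr0 using fun i : Fin n => hC.exists_param_notMem (i, b) 0
  choose r' hrr' hr1 using fun i : Fin n => hC.exists_param_notMem (i, b) (r i)
  have hrd : ∀ i, InDomain b (r i) := fun i => ⟨fun _ => (hr i).le, fun h => absurd hb h.ne⟩
  set S := ⋃ i, (C i).carrier with hS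
  have hSc : IsClosed S := isClosed_iUnion_of_finite fun i => (C i).isClosed_carrier
  have hsub : ∀ i, (C i).carrier ⊆ S := fun i => subset_iUnion (fun i => (C i).carrier) i
  let v : ArmPair n k ⊕ (Fin n ⊕ Unit) → Plane → ℝ :=
    Sum.elim (fun y => Sᶜ.indicator (pathAngle C y.1.1 y.1.2 (s y) (t y)))
      (Sum.elim (fun i => Sᶜ.indicator (pathAngle C (i, b) (i, b) (r i) (r i)))
        fun _ => Sᶜ.indicator fun _ => 1)
  have hv : ∀ j, v j ∈ locConst S := by
    rintro (y | i | _)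
    · exact indicator_pathAngle_mem_locConst hSc (hsub _) (hsub _) (hs y) (ht y) (hst y)
    · exact indicator_pathAngle_mem_locConst hSc (hsub _) (hsub _) (hrd i) (hrd i) rfl
    · exact indicator_mem_locConst_of_angle hSc (fun _ _ => continuousAt_const) fun _ _ => rfl
  have hli : LinearIndependent ℝ v := by
    rw [Fintype.linearIndependent_iff]
    intro g hg
    have hF : ∀ z ∉ S, (∑ y, g (Sum.inl y) * pathAngle C y.1.1 y.1.2 (s y) (t y) z) +
        ((∑ i, g (Sum.inr (Sum.inl i)) * pathAngle C (i, b) (i, b) (r i) (r i) z) +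
          g (Sum.inr (Sum.inr ()))) = 0 := by
      intro z hz
      have h1 := congrFun hg z
      have hz' : z ∈ Sᶜ := hz
      simpa [v, Fintype.sum_sum_type, indicator_of_mem hz'] using h1
    obtain ⟨h1, h2, h3⟩ := hC.linearIndependent_pathAngle hs hs' ht hst hb hrd hrr' hr0 hr1
      (c := fun y => g (Sum.inl y)) (e := fun i => g (Sum.inr (Sum.inl i))) hF
    rintro (y | i | ⟨⟩)
    · exact congrFun h1 y
    · exact congrFun h2 i
    · exact h3
  have := card_le_encard_planeRegions hli hv
  rw [Fintype.card_sum, Fintype.card_sum, card_armPair, Fintype.card_fin, Fintype.card_unit] at this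
  refine le_trans ?_ this
  rw [maxRegions]
  exact_mod_cast (by omega)

end InGeneralPosition

/-! ### Counting self-crossings and intersections -/

theorem encard_le_of_subset_range {T X : Type*} [Fintype T] {A : Set X} (f : T → X)
    (h : A ⊆ range f) : A.encard ≤ Fintype.card T := by
  refine (encard_le_encard h).trans ?_
  rw [← image_univ]
  refine (encard_image_le f univ).trans ?_
  rw [encard_univ, ENat.card_eq_coe_fintype_card]

theorem le_encard_of_injective {T X : Type*} [Fintype T] {A : Set X} {f : T → X}
    (hf : Function.Injective f) (h : ∀ t, f t ∈ A) : (Fintype.card T : ℕ∞) ≤ A.encard := by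
  have := encard_le_encard (range_subset_iff.2 h)
  rwa [← image_univ, hf.encard_image, encard_univ, ENat.card_eq_coe_fintype_card] at this

namespace Chain

variable {k : ℕ}

/-- If two consecutive open arms meet at `p`, both contain the midpoint of `p` and their common
bend, so `p` is not their only common point. -/
theorem openArm_inter_succ_ne_singleton (C : Chain k) {i j : Fin k} (h : (i : ℕ) + 1 = j)
    (p : Plane) : C.openArm i ∩ C.openArm j ≠ {p} := by
  intro hp
  obtain ⟨hpi, hpj⟩ : p ∈ C.openArm i ∩ C.openArm j := hp ▸ mem_singleton p
  obtain ⟨s, hs, hsp⟩ := mem_openArm.1 hpi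
  obtain ⟨t, ht, htp⟩ := mem_openArm.1 hpj
  have hs1 : s < 1 := hs.2 (by have := j.2; omega)
  have ht0 : 0 < t := ht.1 (by omega)
  have hij : C.pt j.castSucc = C.pt i.castSucc + (1 : ℝ) • C.dir i := by
    have : j.castSucc = i.succ := Fin.ext (by simp [← h])
    rw [this, one_smul, dir, add_sub_cancel]
  have hq : C.pt i.castSucc + ((s + 1) / 2) • C.dir i = C.pt j.castSucc + (t / 2) • C.dir j := by
    have h1 : (t / 2) • C.dir j = (1 / 2 : ℝ) • (p - C.pt j.castSucc) := by
      rw [← htp]; module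
    rw [h1, hij, ← hsp]
    module
  have hmem : C.pt i.castSucc + ((s + 1) / 2) • C.dir i ∈ C.openArm i ∩ C.openArm j := by
    refine ⟨mem_openArm.2 ⟨_, ⟨fun h => ?_, fun _ => by linarith⟩, rfl⟩,
      hq ▸ mem_openArm.2 ⟨_, ⟨fun _ => by linarith, fun h => ?_⟩, rfl⟩⟩
    · linarith [hs.1 h]
    · linarith [ht.2 h]
  rw [hp, mem_singleton_iff, ← hsp] at hmem
  have := C.add_smul_dir_injective i hmem
  linarith

theorem encard_selfCrossings_le (C : Chain k) :
    C.selfCrossings.encard ≤ ((k - 1).choose 2 : ℕ) := by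
  classical
  rw [← card_fin_succ_lt]
  refine encard_le_of_subset_range (fun q : {q : Fin k × Fin k // (q.1 : ℕ) + 1 < q.2} =>
    if h : ∃ p, C.openArm q.1.1 ∩ C.openArm q.1.2 = {p} then h.choose else 0) ?_
  have key : ∀ i j : Fin k, i < j → ∀ p, C.openArm i ∩ C.openArm j = {p} →
      p ∈ range (fun q : {q : Fin k × Fin k // (q.1 : ℕ) + 1 < q.2} =>
        if h : ∃ p, C.openArm q.1.1 ∩ C.openArm q.1.2 = {p} then h.choose else 0) := by
    intro i j hij p hp
    have hij' : (i : ℕ) + 1 < j := by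
      rw [Fin.lt_def] at hij
      refine lt_of_le_of_ne hij fun h => ?_
      exact C.openArm_inter_succ_ne_singleton h p hp
    refine ⟨⟨(i, j), hij'⟩, ?_⟩
    have h : ∃ p, C.openArm i ∩ C.openArm j = {p} := ⟨p, hp⟩
    dsimp only
    rw [dif_pos h]
    exact (singleton_injective (hp.symm.trans h.choose_spec)).symm
  rintro p ⟨i, j, hne, hp⟩
  rcases lt_or_gt_of_ne hne with h | h
  · exact key i j h p hp
  · exact key j i h p (by rwa [inter_comm])

theorem encard_intersections_le (C D : Chain k) :
    (C.intersections D).encard ≤ (k ^ 2 : ℕ) := by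
  classical
  have : k ^ 2 = Fintype.card (Fin k × Fin k) := by simp [sq]
  rw [this]
  refine encard_le_of_subset_range (fun q : Fin k × Fin k =>
    if h : ∃ p, C.arm q.1 ∩ D.arm q.2 = {p} then h.choose else 0) ?_
  rintro p ⟨i, j, hp⟩
  refine ⟨(i, j), ?_⟩
  have h : ∃ p, C.arm i ∩ D.arm j = {p} := ⟨p, hp⟩
  dsimp only
  rw [dif_pos h]
  exact (singleton_injective (hp.symm.trans h.choose_spec)).symm

end Chain

namespace InGeneralPosition

variable {k n : ℕ} {C : Fin n → Chain k}

theorem arm_inter_subsingleton (hC : InGeneralPosition C) {α β : Fin n × Fin k} (h : α ≠ β) :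
    ((C α.1).arm α.2 ∩ (C β.1).arm β.2).Subsingleton := by
  rintro x ⟨hx, hx'⟩ y ⟨hy, hy'⟩
  obtain ⟨s, -, rfl⟩ := exists_point_of_mem_arm hx
  obtain ⟨t, -, rfl⟩ := exists_point_of_mem_arm hy
  rw [hC.subsingleton_params h hx' hy']

/-- By the absence of triple points, different pairs of arms cross at different points. -/
theorem encard_selfCrossings (hC : InGeneralPosition C)
    (hcross : ∀ y : ArmPair n k,
      ((C y.1.1.1).openArm y.1.1.2 ∩ (C y.1.2.1).openArm y.1.2.2).Nonempty) (i : Fin n) :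
    (C i).selfCrossings.encard = ((k - 1).choose 2 : ℕ) := by
  refine le_antisymm (encard_selfCrossings_le _) ?_
  let T := {q : Fin k × Fin k // (q.1 : ℕ) + 1 < q.2}
  let pair : T → ArmPair n k := fun q => ⟨((i, q.1.1), (i, q.1.2)), Or.inr ⟨rfl, q.2⟩⟩
  choose f hf using fun q : T => hcross (pair q)
  rw [← card_fin_succ_lt]
  refine le_encard_of_injective (f := f) (fun q q' hqq => ?_) fun q => ?_
  · have h1 := hf q
    have h2 := hf q'
    rw [← hqq] at h2
    rcases hC.eq_of_mem (pair q).ne (pair q').ne (openArm_subset_arm _ _ h1.1)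
      (openArm_subset_arm _ _ h1.2) (openArm_subset_arm _ _ h2.1)
      (openArm_subset_arm _ _ h2.2) with h | h
    · simp only [pair, Prod.mk.injEq, true_and] at h
      exact Subtype.ext (Prod.ext h.1 h.2)
    · have := ArmPair.eq_of_swap h.1 h.2
      simp only [pair, Subtype.mk.injEq, Prod.mk.injEq, true_and] at this
      exact Subtype.ext (Prod.ext this.1 this.2)
  · refine ⟨q.1.1, q.1.2, fun h => ?_, ?_⟩
    · have := q.2
      rw [h] at this
      omega
    · refine Subsingleton.eq_singleton_of_mem ?_ (hf q)
      exact (hC.arm_inter_subsingleton (pair q).ne).anti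
        (inter_subset_inter (openArm_subset_arm _ _) (openArm_subset_arm _ _))

theorem encard_intersections (hC : InGeneralPosition C)
    (hcross : ∀ y : ArmPair n k,
      ((C y.1.1.1).openArm y.1.1.2 ∩ (C y.1.2.1).openArm y.1.2.2).Nonempty) {i j : Fin n}
    (hij : i ≠ j) : ((C i).intersections (C j)).encard = (k ^ 2 : ℕ) := by
  refine le_antisymm (encard_intersections_le _ _) ?_
  have hne : ∀ q : Fin k × Fin k, (i, q.1) ≠ (j, q.2) := fun q h => hij (Prod.ext_iff.1 h).1
  have hex : ∀ q : Fin k × Fin k, ∃ p, p ∈ (C i).arm q.1 ∧ p ∈ (C j).arm q.2 := by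
    intro q
    rcases lt_or_gt_of_ne hij with h | h
    · obtain ⟨p, hp⟩ := hcross ⟨((i, q.1), (j, q.2)), Or.inl h⟩
      exact ⟨p, openArm_subset_arm _ _ hp.1, openArm_subset_arm _ _ hp.2⟩
    · obtain ⟨p, hp⟩ := hcross ⟨((j, q.2), (i, q.1)), Or.inl h⟩
      exact ⟨p, openArm_subset_arm _ _ hp.2, openArm_subset_arm _ _ hp.1⟩
  choose f hf using hex
  have : k ^ 2 = Fintype.card (Fin k × Fin k) := by simp [sq]
  rw [this]
  refine le_encard_of_injective (f := f) (fun q q' hqq => ?_) fun q => ⟨q.1, q.2, ?_⟩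
  · have h2 := hf q'
    rw [← hqq] at h2
    rcases hC.eq_of_mem (hne q) (hne q') (hf q).1 (hf q).2 h2.1 h2.2 with h | h
    · exact Prod.ext (Prod.ext_iff.1 h.1).2 (Prod.ext_iff.1 h.2).2
    · exact (hij (Prod.ext_iff.1 h.1).1).elim
  · exact Subsingleton.eq_singleton_of_mem (hC.arm_inter_subsingleton (hne q)) (hf q)

end InGeneralPosition

/-! ### Zigzag chains -/

/-- A chain that turns back and forth between the vertical lines at abscissas `0` and `1`, at the
heights given by `l` and `r`. -/
def zigzag (k : ℕ) (l r : ℕ → ℝ) : Chain k where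
  pt j := if Even (j : ℕ) then !₂[0, l j] else !₂[1, r j]
  ne i h := by
    have h0 := congrFun (congrArg (fun z : Plane => (z : Fin 2 → ℝ)) h) 0
    by_cases hi : Even (i : ℕ) <;> simp [hi, Nat.even_add_one] at h0

/-- The heights of consecutive bends of a zigzag chain fit together. -/
structure ZigzagHeights (l r : ℕ → ℝ) : Prop where
  left : ∀ a, Odd a → l (a + 1) = l a
  right : ∀ a, Even a → r (a + 1) = r a

section Zigzag

variable {k : ℕ} {l r : ℕ → ℝ} (h : ZigzagHeights l r)
include h

theorem zigzag_dir_even {a : Fin k} (ha : Even (a : ℕ)) :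
    (zigzag k l r).dir a = !₂[1, r a - l a] := by
  ext i
  fin_cases i <;> simp [Chain.dir, zigzag, ha, Nat.even_add_one, h.right _ ha]

theorem zigzag_dir_odd {a : Fin k} (ha : ¬Even (a : ℕ)) :
    (zigzag k l r).dir a = !₂[-1, l a - r a] := by
  ext i
  fin_cases i <;> simp [Chain.dir, zigzag, ha, Nat.even_add_one,
    h.left _ (Nat.not_even_iff_odd.1 ha)]

/-- Even arms run from left to right, odd ones back, so the abscissa is the parameter or its
complement to 1. -/
theorem zigzag_point {a : Fin k} (s : ℝ) : (zigzag k l r).point a s =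
    if Even (a : ℕ) then !₂[s, (1 - s) * l a + s * r a]
    else !₂[1 - s, (1 - (1 - s)) * l a + (1 - s) * r a] := by
  split_ifs with ha
  · ext i
    rw [Chain.point, zigzag_dir_even h ha]
    fin_cases i
    · simp [zigzag, ha]
    · simp [zigzag, ha]; ring
  · ext i
    rw [Chain.point, zigzag_dir_odd h ha]
    fin_cases i
    · simp [zigzag, ha]; ring
    · simp [zigzag, ha]; ring

theorem eq_of_mem_zigzag_arm {a : Fin k} {z : Plane} (hz : z ∈ (zigzag k l r).arm a) :
    z 1 = (1 - z 0) * l a + z 0 * r a := by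
  obtain ⟨s, -, rfl⟩ := exists_point_of_mem_arm hz
  rw [zigzag_point h]
  split_ifs <;> simp

/-- For even `k` both infinite arms extend to the left. -/
theorem le_one_of_mem_zigzag_arm (hk : Even k) {a : Fin k} {z : Plane}
    (hz : z ∈ (zigzag k l r).arm a) : z 0 ≤ 1 := by
  obtain ⟨s, hs, rfl⟩ := exists_point_of_mem_arm hz
  rw [zigzag_point h]
  split_ifs with ha
  · have : (a : ℕ) + 1 < k := by
      have := a.2
      refine lt_of_le_of_ne this fun he => ?_
      rw [← he, Nat.even_add_one] at hk
      exact hk ha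
    simpa using hs.2 this
  · have : 0 < (a : ℕ) := Nat.pos_of_ne_zero fun h0 => ha (by simp [h0])
    simpa using hs.1 this

theorem mem_zigzag_openArm {a : Fin k} {u : ℝ} (hu : u ∈ Ioo (0 : ℝ) 1) :
    !₂[u, (1 - u) * l a + u * r a] ∈ (zigzag k l r).openArm a := by
  rw [mem_openArm]
  by_cases ha : Even (a : ℕ)
  · refine ⟨u, ⟨fun _ => hu.1, fun _ => hu.2⟩, (zigzag_point h u).trans ?_⟩
    rw [if_pos ha]
  · refine ⟨1 - u, ⟨fun _ => by linarith [hu.2], fun _ => by linarith [hu.1]⟩,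
      (zigzag_point h (1 - u)).trans ?_⟩
    rw [if_neg ha, sub_sub_cancel]

end Zigzag

theorem exists_crossing {a b c d : ℝ} (h : (a - b) * (c - d) < 0) :
    ∃ u ∈ Ioo (0 : ℝ) 1, (1 - u) * a + u * c = (1 - u) * b + u * d := by
  have hne : (a - b) - (c - d) ≠ 0 := by
    intro h0
    rw [← sub_eq_zero.1 h0] at h
    exact (mul_self_nonneg _).not_gt h
  -- The zero of the affine function with values `a - b` at 0 and `c - d` at 1.
  refine ⟨(a - b) / ((a - b) - (c - d)), ⟨?_, ?_⟩, ?_⟩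
  · rcases mul_neg_iff.1 h with ⟨h1, h2⟩ | ⟨h1, h2⟩
    · exact div_pos h1 (by linarith)
    · exact div_pos_of_neg_of_neg h1 (by linarith)
  · rcases mul_neg_iff.1 h with ⟨h1, h2⟩ | ⟨h1, h2⟩
    · rw [div_lt_one (by linarith)]; linarith
    · rw [div_lt_one_of_neg (by linarith)]; linarith
  · field_simp
    ring

theorem not_concurrent {a b c a' b' c' : ℝ}
    (h : (b - a) * (c' - a') - (c - a) * (b' - a') ≠ 0) {u y : ℝ}
    (h1 : y = (1 - u) * a + u * a') (h2 : y = (1 - u) * b + u * b') :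
    y ≠ (1 - u) * c + u * c' := by
  intro h3
  apply h
  have e1 : u * ((b - a) * (c' - a') - (c - a) * (b' - a')) = 0 := by
    linear_combination (c - a) * (h2 - h1) - (b - a) * (h3 - h1)
  have e2 : (1 - u) * ((b - a) * (c' - a') - (c - a) * (b' - a')) = 0 := by
    linear_combination -(c' - a') * (h2 - h1) + (b' - a') * (h3 - h1)
  linear_combination e1 + e2

section ZigzagFamily

variable {k n : ℕ} {l r : Fin n → ℕ → ℝ}

/-- Equal differences of heights mean parallel lines, and lines through a common point have
collinear height pairs. Both conditions concern full lines, so the orientation and the extent of the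
arms do not matter. -/
theorem inGeneralPosition_zigzag (h : ∀ i, ZigzagHeights (l i) (r i))
    (h1 : ∀ α β : Fin n × Fin k, α ≠ β → l α.1 α.2 - l β.1 β.2 ≠ r α.1 α.2 - r β.1 β.2)
    (h2 : ∀ α β γ : Fin n × Fin k, α ≠ β → α ≠ γ → β ≠ γ →
      (l β.1 β.2 - l α.1 α.2) * (r γ.1 γ.2 - r α.1 α.2) -
        (l γ.1 γ.2 - l α.1 α.2) * (r β.1 β.2 - r α.1 α.2) ≠ 0) :
    InGeneralPosition fun i => zigzag k (l i) (r i) where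
  dir_ne i a := by
    by_cases ha : Even (a : ℕ)
    · simp [zigzag_dir_even (h i) ha]
    · simp [zigzag_dir_odd (h i) ha]
  cross_ne α β hαβ := by
    have h3 := h1 α β hαβ
    by_cases ha : Even (α.2 : ℕ) <;> by_cases hb : Even (β.2 : ℕ)
    · rw [zigzag_dir_even (h _) ha, zigzag_dir_even (h _) hb]
      intro h0
      simp at h0
      exact h3 (by linarith)
    · rw [zigzag_dir_even (h _) ha, zigzag_dir_odd (h _) hb]
      intro h0
      simp at h0
      exact h3 (by linarith)
    · rw [zigzag_dir_odd (h _) ha, zigzag_dir_even (h _) hb]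
      intro h0
      simp at h0
      exact h3 (by linarith)
    · rw [zigzag_dir_odd (h _) ha, zigzag_dir_odd (h _) hb]
      intro h0
      simp at h0
      exact h3 (by linarith)
  triple α β γ hαβ hαγ hβγ x hx hx' hx'' :=
    not_concurrent (h2 α β γ hαβ hαγ hβγ) (eq_of_mem_zigzag_arm (h _) hx)
      (eq_of_mem_zigzag_arm (h _) hx') (eq_of_mem_zigzag_arm (h _) hx'')

theorem zigzag_crossing (h : ∀ i, ZigzagHeights (l i) (r i))
    (h3 : ∀ y : ArmPair n k,
      (l y.1.1.1 y.1.1.2 - l y.1.2.1 y.1.2.2) * (r y.1.1.1 y.1.1.2 - r y.1.2.1 y.1.2.2) < 0)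
    (y : ArmPair n k) : ((zigzag k (l y.1.1.1) (r y.1.1.1)).openArm y.1.1.2 ∩
      (zigzag k (l y.1.2.1) (r y.1.2.1)).openArm y.1.2.2).Nonempty := by
  obtain ⟨u, hu, he⟩ := exists_crossing (h3 y)
  refine ⟨_, mem_zigzag_openArm (h _) hu, ?_⟩
  rw [he]
  exact mem_zigzag_openArm (h _) hu

end ZigzagFamily

/-! ### The model chain and the lines it is added to -/

/-- The left bends of the model chain. -/
def modelLeft (a : ℕ) : ℝ := ((a + 1) / 2 : ℕ)

/-- The right bends of the model chain. -/
def modelRight (a : ℕ) : ℝ := -4 ^ (a / 2)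

/-- The points where the lines of the pancake graph meet the vertical axis. -/
def lineLeft (n i : ℕ) : ℝ := (2 * n + 1) * i

/-- The points where the lines of the pancake graph meet the vertical line at abscissa `1`. -/
def lineRight (i : ℕ) : ℝ := -(i : ℝ) ^ 2

theorem four_pow_growth {a b : ℕ} (h : a < b) : ((b : ℝ) - a + 1) * 4 ^ a ≤ 4 ^ b - 4 ^ a := by
  induction b, h using Nat.le_induction with
  | base => push_cast; rw [pow_succ]; nlinarith [pow_pos (four_pos (α := ℝ)) a]
  | succ b hab ih =>
    push_cast
    rw [pow_succ]
    have h1 : (4 : ℝ) ^ a ≤ 4 ^ b := pow_le_pow_right₀ (by norm_num) (by omega)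
    have h2 : (0 : ℝ) < 4 ^ a := by positivity
    have e : ((b : ℝ) + 1 - a + 1) * 4 ^ a = (b - a + 1) * 4 ^ a + 4 ^ a := by ring
    rw [e]
    linarith

theorem modelLeft_mono {a b : ℕ} (h : a ≤ b) : modelLeft a ≤ modelLeft b := by
  unfold modelLeft
  exact_mod_cast Nat.div_le_div_right (by omega)

theorem modelRight_anti {a b : ℕ} (h : a ≤ b) : modelRight b ≤ modelRight a := by
  unfold modelRight
  exact neg_le_neg (pow_le_pow_right₀ (by norm_num) (Nat.div_le_div_right h))

theorem modelLeft_lt {a b : ℕ} (h : (a + 1) / 2 < (b + 1) / 2) :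
    modelLeft a + 1 ≤ modelLeft b := by
  unfold modelLeft
  exact_mod_cast h

theorem modelRight_lt {a b : ℕ} (h : a / 2 < b / 2) : modelRight b < modelRight a := by
  unfold modelRight
  exact neg_lt_neg (pow_lt_pow_right₀ (by norm_num) h)

/-- The powers of 4 drop fast enough to outrun the linear growth on the left, even with the extra
step that rounding up can add. -/
theorem modelLeft_sub_le {a b : ℕ} (h : a / 2 < b / 2) :
    (modelLeft b - modelLeft a) * 4 ^ (a / 2) ≤ modelRight a - modelRight b := by
  have h1 := four_pow_growth h
  have h2 : modelLeft b - modelLeft a ≤ (b / 2 : ℕ) - (a / 2 : ℕ) + 1 := by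
    unfold modelLeft
    have : ((b + 1) / 2 : ℕ) + (a / 2 : ℕ) ≤ b / 2 + 1 + (a + 1) / 2 := by omega
    have h3 : ((((b + 1) / 2 : ℕ) + (a / 2 : ℕ) : ℕ) : ℝ) ≤ ((b / 2 + 1 + (a + 1) / 2 : ℕ) : ℝ) := by
      exact_mod_cast this
    push_cast at h3 ⊢
    linarith
  have h3 : (modelLeft b - modelLeft a) * 4 ^ (a / 2) ≤
      ((b / 2 : ℕ) - (a / 2 : ℕ) + 1) * 4 ^ (a / 2) :=
    mul_le_mul_of_nonneg_right h2 (by positivity)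
  unfold modelRight
  linarith

/-- The height pairs form a descending staircase. If two neighbours share a coordinate, exactly one
of the two products below vanishes; otherwise the descent from `b` to `c` is steeper than the one
from `a` to `b`. -/
theorem model_det_ne_of_lt {a b c : ℕ} (hab : a < b) (hbc : b < c) :
    (modelLeft b - modelLeft a) * (modelRight c - modelRight a) -
      (modelLeft c - modelLeft a) * (modelRight b - modelRight a) ≠ 0 := by
  have e : (modelLeft b - modelLeft a) * (modelRight c - modelRight a) -
      (modelLeft c - modelLeft a) * (modelRight b - modelRight a) =
      (modelLeft c - modelLeft b) * (modelRight a - modelRight b) -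
      (modelLeft b - modelLeft a) * (modelRight b - modelRight c) := by ring
  rw [e]
  have hx := modelLeft_mono hab.le
  have hy := modelLeft_mono hbc.le
  rcases (Nat.div_le_div_right (c := 2) hab.le).eq_or_lt with hA | hA
  · have hp : modelRight a = modelRight b := by unfold modelRight; rw [hA]
    have h1 := modelLeft_lt (a := a) (b := b) (by omega)
    have h2 := modelRight_lt (a := b) (b := c) (by omega)
    rw [hp]
    nlinarith
  have hp := modelRight_lt hA
  rcases (Nat.div_le_div_right (c := 2) hbc.le).eq_or_lt with hB | hB
  · have hq : modelRight b = modelRight c := by unfold modelRight; rw [hB]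
    have h1 := modelLeft_lt (a := b) (b := c) (by omega)
    rw [hq]
    nlinarith
  have hq := modelRight_lt hB
  rcases (Nat.div_le_div_right (c := 2) (Nat.add_le_add_right hab.le 1)).eq_or_lt with hC | hC
  · have hx0 : modelLeft a = modelLeft b := by unfold modelLeft; rw [hC]
    have h1 := modelLeft_lt (a := b) (b := c) (by omega)
    rw [hx0]
    nlinarith
  -- The second product dominates: the drop from `b` to `c` is at least `4 ^ (b / 2)` times the step
  -- on the left, and `4 ^ (b / 2)` exceeds the drop from `a` to `b`.
  have h1 := modelLeft_lt hC
  have h2 := modelLeft_sub_le hB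
  have h3 : modelRight a - modelRight b < 4 ^ (b / 2) := by
    unfold modelRight
    linarith [pow_pos (four_pos (α := ℝ)) (a / 2)]
  refine ne_of_lt ?_
  have h4 : modelRight b - modelRight c ≤
      (modelLeft b - modelLeft a) * (modelRight b - modelRight c) := by nlinarith
  rcases hy.eq_or_lt with hy | hy
  · rw [hy, sub_self, zero_mul, ← hy]
    linarith
  · nlinarith [mul_lt_mul_of_pos_left h3 (sub_pos.2 hy)]

theorem model_det_ne {a b c : ℕ} (hab : a ≠ b) (hac : a ≠ c) (hbc : b ≠ c) :
    (modelLeft b - modelLeft a) * (modelRight c - modelRight a) -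
      (modelLeft c - modelLeft a) * (modelRight b - modelRight a) ≠ 0 := by
  intro h0
  rcases lt_or_gt_of_ne hab with h1 | h1 <;> rcases lt_or_gt_of_ne hac with h2 | h2 <;>
    rcases lt_or_gt_of_ne hbc with h3 | h3
  · exact model_det_ne_of_lt h1 h3 h0
  · exact model_det_ne_of_lt h2 h3 (by linarith)
  · omega
  · exact model_det_ne_of_lt h2 h1 (by linarith)
  · exact model_det_ne_of_lt h1 h2 (by linarith)
  · omega
  · exact model_det_ne_of_lt h3 h2 (by linarith)
  · exact model_det_ne_of_lt h3 h1 (by linarith)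

theorem model_sub_ne_of_lt {a b : ℕ} (h : a < b) :
    modelLeft b - modelLeft a ≠ modelRight b - modelRight a := by
  have h1 := modelLeft_mono h.le
  have h2 := modelRight_anti h.le
  intro he
  by_cases hA : a / 2 < b / 2
  · linarith [modelRight_lt hA]
  · linarith [modelLeft_lt (a := a) (b := b) (by omega)]

/-- Two height pairs of the model span a direction that is horizontal or at least as steep as a
diagonal. For two lines the slope has absolute value (i + j)/(2n + 1), strictly between 0 and 1;
this is the reason for the factor `2 * n + 1`. -/
theorem line_model_ne_of_lt {n i j a b : ℕ} (hi : i < n) (hj : j < n) (hij : i ≠ j)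
    (h : a < b) : (modelLeft b - modelLeft a) * (lineRight j - lineRight i) ≠
      (lineLeft n j - lineLeft n i) * (modelRight b - modelRight a) := by
  have hi' : (i : ℝ) + 1 ≤ n := by exact_mod_cast hi
  have hj' : (j : ℝ) + 1 ≤ n := by exact_mod_cast hj
  have hij' : (j : ℝ) - i ≠ 0 := sub_ne_zero.2 (by exact_mod_cast hij.symm)
  have hpos : (0 : ℝ) < i + j := by
    have : 0 < i + j := by omega
    exact_mod_cast this
  have hl := modelLeft_mono h.le
  intro he
  have h1 : ((j : ℝ) - i) * ((2 * n + 1) * (modelRight a - modelRight b) -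
      (modelLeft b - modelLeft a) * (i + j)) = 0 := by
    unfold lineRight lineLeft at he
    linear_combination he
  have h2 := (mul_eq_zero.1 h1).resolve_left hij'
  by_cases hA : a / 2 < b / 2
  · have h3 := modelRight_lt hA
    have h4 : modelLeft b - modelLeft a ≤ modelRight a - modelRight b := by
      refine le_trans ?_ (modelLeft_sub_le hA)
      exact le_mul_of_one_le_right (by linarith) (one_le_pow₀ (by norm_num))
    nlinarith
  · have hp : modelRight a = modelRight b := by
      unfold modelRight
      rw [show a / 2 = b / 2 by omega]
    have h3 := modelLeft_lt (a := a) (b := b) (by omega)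
    rw [hp] at h2
    nlinarith

theorem line_model_ne {n i j a b : ℕ} (hi : i < n) (hj : j < n) (hij : i ≠ j) (h : a ≠ b) :
    (modelLeft b - modelLeft a) * (lineRight j - lineRight i) ≠
      (lineLeft n j - lineLeft n i) * (modelRight b - modelRight a) := by
  rcases lt_or_gt_of_ne h with h | h
  · exact line_model_ne_of_lt hi hj hij h
  · intro he
    exact line_model_ne_of_lt hi hj hij h (by linarith)

theorem line_mul_neg (n : ℕ) {i j : ℕ} (hij : i ≠ j) :
    (lineLeft n i - lineLeft n j) * (lineRight i - lineRight j) < 0 := by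
  have hij' : (i : ℝ) - j ≠ 0 := sub_ne_zero.2 (by exact_mod_cast hij)
  have hpos : (0 : ℝ) < i + j := by
    have : 0 < i + j := by omega
    exact_mod_cast this
  have e : (lineLeft n i - lineLeft n j) * (lineRight i - lineRight j) =
      -((2 * n + 1) * (i + j) * ((i : ℝ) - j) ^ 2) := by
    unfold lineLeft lineRight; ring
  rw [e, neg_lt_zero]
  have := pow_pos (abs_pos.2 hij') 2
  rw [sq_abs] at this
  positivity

/-- The height pairs of the lines lie on a parabola, so the determinant is of Vandermonde type. -/
theorem line_det_ne (n : ℕ) {i j m : ℕ} (hij : i ≠ j) (him : i ≠ m) (hjm : j ≠ m) :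
    (lineLeft n j - lineLeft n i) * (lineRight m - lineRight i) -
      (lineLeft n m - lineLeft n i) * (lineRight j - lineRight i) ≠ 0 := by
  have h1 : (j : ℝ) - i ≠ 0 := sub_ne_zero.2 (by exact_mod_cast hij.symm)
  have h2 : (m : ℝ) - i ≠ 0 := sub_ne_zero.2 (by exact_mod_cast him.symm)
  have h3 : (j : ℝ) - m ≠ 0 := sub_ne_zero.2 (by exact_mod_cast hjm)
  have e : (lineLeft n j - lineLeft n i) * (lineRight m - lineRight i) -
      (lineLeft n m - lineLeft n i) * (lineRight j - lineRight i) =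
      (2 * n + 1) * (j - i) * (m - i) * (j - m) := by
    unfold lineLeft lineRight; ring
  rw [e]
  have : (2 * (n : ℝ) + 1) ≠ 0 := by positivity
  exact mul_ne_zero (mul_ne_zero (mul_ne_zero this h1) h2) h3

/-! ### Narrow chains for small δ -/

/-- The heights of the left bends of the `i`-th chain of a narrow family. -/
def narrowLeft (n : ℕ) (δ : ℝ) (i a : ℕ) : ℝ := lineLeft n i + δ * modelLeft a

/-- The heights of the right bends of the `i`-th chain of a narrow family. -/
def narrowRight (δ : ℝ) (i a : ℕ) : ℝ := lineRight i + δ * modelRight a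

theorem zigzagHeights_narrow (n : ℕ) (δ : ℝ) (i : ℕ) :
    ZigzagHeights (narrowLeft n δ i) (narrowRight δ i) where
  left a ha := by
    obtain ⟨m, rfl⟩ := ha
    unfold narrowLeft modelLeft
    rw [show (2 * m + 1 + 1 + 1) / 2 = (2 * m + 1 + 1) / 2 by omega]
  right a ha := by
    obtain ⟨m, rfl⟩ := ha
    unfold narrowRight modelRight
    rw [show (m + m + 1) / 2 = (m + m) / 2 by omega]

theorem eventually_ne_of_continuous {f : ℝ → ℝ} (hf : Continuous f) (h : f 0 ≠ 0) :
    ∀ᶠ δ in 𝓝[>] 0, f δ ≠ 0 :=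
  (hf.continuousAt.eventually_ne h).filter_mono nhdsWithin_le_nhds

theorem eventually_neg_of_continuous {f : ℝ → ℝ} (hf : Continuous f) (h : f 0 < 0) :
    ∀ᶠ δ in 𝓝[>] 0, f δ < 0 :=
  (hf.continuousAt.eventually_lt continuousAt_const h).filter_mono nhdsWithin_le_nhds

theorem eventually_narrow_sub_ne {n i j a b : ℕ} (h : (i, a) ≠ (j, b)) :
    ∀ᶠ δ in 𝓝[>] 0, narrowLeft n δ i a - narrowLeft n δ j b ≠
      narrowRight δ i a - narrowRight δ j b := by
  by_cases hij : i = j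
  · subst hij
    have hab : a ≠ b := by rintro rfl; exact h rfl
    filter_upwards [self_mem_nhdsWithin] with δ hδ he
    have hδ0 : δ ≠ 0 := ne_of_gt hδ
    have e : modelLeft a - modelLeft b = modelRight a - modelRight b := by
      apply mul_left_cancel₀ hδ0
      unfold narrowLeft narrowRight at he
      linear_combination he
    rcases lt_or_gt_of_ne hab with h | h
    · exact model_sub_ne_of_lt h (by linarith)
    · exact model_sub_ne_of_lt h e
  · have h1 := line_mul_neg n hij
    filter_upwards [eventually_ne_of_continuous
      (f := fun δ => (narrowLeft n δ i a - narrowLeft n δ j b) -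
        (narrowRight δ i a - narrowRight δ j b)) (by unfold narrowLeft narrowRight; fun_prop) (by
        simp only [narrowLeft, narrowRight, zero_mul, add_zero]
        intro h0
        rw [← sub_eq_zero.1 h0] at h1
        exact (mul_self_nonneg _).not_gt h1)] with δ hδ
    exact sub_ne_zero.1 hδ

/-- Three points in the plane of bend heights are collinear if and only if this is zero. -/
def narrowDet (n : ℕ) (δ : ℝ) (α β γ : ℕ × ℕ) : ℝ :=
  (narrowLeft n δ β.1 β.2 - narrowLeft n δ α.1 α.2) *
      (narrowRight δ γ.1 γ.2 - narrowRight δ α.1 α.2) -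
    (narrowLeft n δ γ.1 γ.2 - narrowLeft n δ α.1 α.2) *
      (narrowRight δ β.1 β.2 - narrowRight δ α.1 α.2)

theorem narrowDet_rotate (n : ℕ) (δ : ℝ) (α β γ : ℕ × ℕ) :
    narrowDet n δ α β γ = narrowDet n δ β γ α := by
  unfold narrowDet; ring

/-- The determinant is divisible by δ; the quotient at δ = 0 compares a direction of the model with
one of the lines. -/
theorem eventually_narrowDet_ne_of_eq {n i j a b c : ℕ} (hi : i < n) (hj : j < n) (hij : i ≠ j)
    (hab : a ≠ b) : ∀ᶠ δ in 𝓝[>] 0, narrowDet n δ (i, a) (i, b) (j, c) ≠ 0 := by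
  have h := line_model_ne hi hj hij hab
  filter_upwards [self_mem_nhdsWithin, eventually_ne_of_continuous
    (f := fun δ => (modelLeft b - modelLeft a) *
      (lineRight j - lineRight i + δ * (modelRight c - modelRight a)) -
      (lineLeft n j - lineLeft n i + δ * (modelLeft c - modelLeft a)) *
        (modelRight b - modelRight a)) (by fun_prop) (by
      simp only [zero_mul, add_zero]
      exact sub_ne_zero.2 h)] with δ hδ h1
  have hδ0 : δ ≠ 0 := ne_of_gt hδ
  have := mul_ne_zero hδ0 h1
  convert this using 1
  simp only [narrowDet, narrowLeft, narrowRight]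
  ring

/-- Three arms of one chain give δ² times the model determinant, two of one chain the previous case,
and arms of three chains a perturbation of the determinant of their lines. -/
theorem eventually_narrowDet_ne {n : ℕ} {α β γ : ℕ × ℕ} (hα : α.1 < n) (hβ : β.1 < n)
    (hγ : γ.1 < n) (hαβ : α ≠ β) (hαγ : α ≠ γ) (hβγ : β ≠ γ) :
    ∀ᶠ δ in 𝓝[>] 0, narrowDet n δ α β γ ≠ 0 := by
  obtain ⟨i, a⟩ := α
  obtain ⟨j, b⟩ := β
  obtain ⟨m, c⟩ := γ
  by_cases hij : i = j
  · subst hij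
    have hab : a ≠ b := by rintro rfl; exact hαβ rfl
    by_cases him : i = m
    · subst him
      have hac : a ≠ c := by rintro rfl; exact hαγ rfl
      have hbc : b ≠ c := by rintro rfl; exact hβγ rfl
      filter_upwards [self_mem_nhdsWithin] with δ hδ
      have hδ0 : δ ≠ 0 := ne_of_gt hδ
      convert mul_ne_zero (pow_ne_zero 2 hδ0) (model_det_ne hab hac hbc) using 1
      simp only [narrowDet, narrowLeft, narrowRight]
      ring
    · exact eventually_narrowDet_ne_of_eq hα hγ him hab
  · by_cases him : i = m
    · subst him
      have hca : c ≠ a := by rintro rfl; exact hαγ rfl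
      simp_rw [narrowDet_rotate n _ (i, a), narrowDet_rotate n _ (j, b)]
      exact eventually_narrowDet_ne_of_eq hα hβ hij hca
    · by_cases hjm : j = m
      · subst hjm
        have hbc : b ≠ c := by rintro rfl; exact hβγ rfl
        simp_rw [narrowDet_rotate n _ (i, a)]
        exact eventually_narrowDet_ne_of_eq hβ hα (Ne.symm hij) hbc
      · refine eventually_ne_of_continuous
          (by unfold narrowDet narrowLeft narrowRight; fun_prop) ?_
        simp only [narrowDet, narrowLeft, narrowRight, zero_mul, add_zero]
        exact line_det_ne n hij him hjm

/-- Different chains cross because their lines do. Within one chain, non-adjacent arms differ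
strictly in both model heights, in opposite senses. -/
theorem eventually_narrow_mul_neg {n i j a b : ℕ} (h : i < j ∨ (i = j ∧ a + 1 < b)) :
    ∀ᶠ δ in 𝓝[>] 0, (narrowLeft n δ i a - narrowLeft n δ j b) *
      (narrowRight δ i a - narrowRight δ j b) < 0 := by
  rcases h with h | ⟨rfl, h⟩
  · refine eventually_neg_of_continuous (by unfold narrowLeft narrowRight; fun_prop) ?_
    simp only [narrowLeft, narrowRight, zero_mul, add_zero]
    exact line_mul_neg n h.ne
  · filter_upwards [self_mem_nhdsWithin] with δ hδ
    have hδ' : 0 < δ := hδ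
    have h1 := modelLeft_lt (a := a) (b := b) (by omega)
    have h2 := modelRight_lt (a := a) (b := b) (by omega)
    have e : (narrowLeft n δ i a - narrowLeft n δ i b) * (narrowRight δ i a - narrowRight δ i b) =
        δ ^ 2 * ((modelLeft a - modelLeft b) * (modelRight a - modelRight b)) := by
      simp only [narrowLeft, narrowRight]; ring
    rw [e]
    exact mul_neg_of_pos_of_neg (by positivity)
      (mul_neg_of_neg_of_pos (by linarith) (by linarith))

/-- In the limit this is minus a square minus 1; up to sign it is the inner product of the
directions of the two infinite arms. -/
theorem eventually_narrow_ends (n i a b : ℕ) : ∀ᶠ δ in 𝓝[>] 0,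
    -((narrowLeft n δ i a - narrowRight δ i a) * (narrowLeft n δ i b - narrowRight δ i b)) - 1
      < 0 := by
  refine eventually_neg_of_continuous (by unfold narrowLeft narrowRight; fun_prop) ?_
  simp only [narrowLeft, narrowRight, zero_mul, add_zero]
  linarith [mul_self_nonneg (lineLeft n i - lineRight i)]

/-- The chains of a narrow family. -/
def narrowChain (k n : ℕ) (δ : ℝ) (i : Fin n) : Chain k :=
  zigzag k (narrowLeft n δ i) (narrowRight δ i)

theorem eventually_narrowChain (k n : ℕ) : ∀ᶠ δ in 𝓝[>] 0,
    InGeneralPosition (narrowChain k n δ) ∧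
    (∀ y : ArmPair n k, ((narrowChain k n δ y.1.1.1).openArm y.1.1.2 ∩
      (narrowChain k n δ y.1.2.1).openArm y.1.2.2).Nonempty) ∧
    ∀ (i : Fin n) (a b : Fin k),
      -((narrowLeft n δ i a - narrowRight δ i a) * (narrowLeft n δ i b - narrowRight δ i b)) - 1
        < 0 := by
  have hinj : ∀ α β : Fin n × Fin k, α ≠ β →
      ((α.1 : ℕ), (α.2 : ℕ)) ≠ ((β.1 : ℕ), (β.2 : ℕ)) := by
    intro α β h he
    simp only [Prod.mk.injEq] at he
    exact h (Prod.ext (Fin.ext he.1) (Fin.ext he.2))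
  have h1 : ∀ᶠ δ in 𝓝[>] 0, ∀ α β : Fin n × Fin k, α ≠ β →
      narrowLeft n δ α.1 α.2 - narrowLeft n δ β.1 β.2 ≠
        narrowRight δ α.1 α.2 - narrowRight δ β.1 β.2 := by
    simp only [eventually_all]
    exact fun α β h => eventually_narrow_sub_ne (hinj α β h)
  have h2 : ∀ᶠ δ in 𝓝[>] 0, ∀ α β γ : Fin n × Fin k, α ≠ β → α ≠ γ → β ≠ γ →
      narrowDet n δ (α.1, α.2) (β.1, β.2) (γ.1, γ.2) ≠ 0 := by
    simp only [eventually_all]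
    exact fun α β γ h h' h'' => eventually_narrowDet_ne α.1.2 β.1.2 γ.1.2 (hinj _ _ h)
      (hinj _ _ h') (hinj _ _ h'')
  have h3 : ∀ᶠ δ in 𝓝[>] 0, ∀ y : ArmPair n k,
      (narrowLeft n δ y.1.1.1 y.1.1.2 - narrowLeft n δ y.1.2.1 y.1.2.2) *
      (narrowRight δ y.1.1.1 y.1.1.2 - narrowRight δ y.1.2.1 y.1.2.2) < 0 := by
    simp only [eventually_all]
    refine fun y => eventually_narrow_mul_neg (y.2.imp (fun h => h) fun h => ?_)
    exact ⟨congrArg Fin.val h.1, h.2⟩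
  have h4 : ∀ᶠ δ in 𝓝[>] 0, ∀ (i : Fin n) (a b : Fin k),
      -((narrowLeft n δ i a - narrowRight δ i a) * (narrowLeft n δ i b - narrowRight δ i b)) - 1
        < 0 := by
    simp only [eventually_all]
    exact fun i a b => eventually_narrow_ends n i a b
  filter_upwards [h1, h2, h3, h4] with δ h1 h2 h3 h4
  exact ⟨inGeneralPosition_zigzag (l := fun i => narrowLeft n δ i) (r := fun i => narrowRight δ i)
      (fun i => zigzagHeights_narrow n δ i) h1 h2,
    zigzag_crossing (l := fun i => narrowLeft n δ i) (r := fun i => narrowRight δ i)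
      (fun i => zigzagHeights_narrow n δ i) h3, h4⟩

/-! ### Pancake and hatpin graphs -/

theorem mem_line_iff {a b : ℝ} {z : Plane} :
    (∃ t : ℝ, z = !₂[0, a] + t • !₂[1, b - a]) ↔ z 1 = (1 - z 0) * a + z 0 * b := by
  constructor
  · rintro ⟨t, rfl⟩
    simp
    ring
  · intro h
    refine ⟨z 0, ?_⟩
    ext i
    fin_cases i
    · simp
    · simp [h]
      ring

theorem mem_ray_iff {a b : ℝ} {z : Plane} :
    (∃ t : ℝ, 0 ≤ t ∧ z = !₂[1, b] + t • !₂[-1, a - b]) ↔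
      z 0 ≤ 1 ∧ z 1 = (1 - z 0) * a + z 0 * b := by
  constructor
  · rintro ⟨t, ht, rfl⟩
    refine ⟨by simpa using ht, ?_⟩
    simp
    ring
  · rintro ⟨h0, h⟩
    refine ⟨1 - z 0, by linarith, ?_⟩
    ext i
    fin_cases i
    · simp
    · simp [h]
      ring

/-- The lines of a pancake graph. -/
def pancakeLine (n : ℕ) (i : Fin n) : Set Plane :=
  {z | z 1 = (1 - z 0) * lineLeft n i + z 0 * lineRight i}

/-- The rays of a hatpin graph. -/
def hatpinRay (n : ℕ) (i : Fin n) : Set Plane :=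
  {z | z 0 ≤ 1 ∧ z 1 = (1 - z 0) * lineLeft n i + z 0 * lineRight i}

theorem hatpinRay_subset (n : ℕ) (i : Fin n) : hatpinRay n i ⊆ pancakeLine n i := fun _ h => h.2

/-- The lines cross between the abscissas 0 and 1, within the half-plane x ≤ 1 that contains the
rays. -/
theorem exists_mem_hatpinRay {n : ℕ} {i j : Fin n} (hij : i ≠ j) :
    ∃ p, p ∈ hatpinRay n i ∧ p ∈ hatpinRay n j := by
  obtain ⟨u, hu, he⟩ := exists_crossing (line_mul_neg n fun h => hij (Fin.ext h))
  exact ⟨!₂[u, (1 - u) * lineLeft n i + u * lineRight i],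
    ⟨by simpa using hu.2.le, by simp⟩, ⟨by simpa using hu.2.le, by simp [he]⟩⟩

theorem pancakeLine_inter_subsingleton {n : ℕ} {i j : Fin n} (hij : i ≠ j) :
    (pancakeLine n i ∩ pancakeLine n j).Subsingleton := by
  rintro x ⟨hx, hx'⟩ y ⟨hy, hy'⟩
  have h := line_mul_neg n (i := i) (j := j) fun h => hij (Fin.ext h)
  simp only [pancakeLine, mem_ofPred_eq] at hx hx' hy hy'
  have h0 : (x 0 - y 0) * ((lineLeft n i - lineLeft n j) - (lineRight i - lineRight j)) = 0 := by
    linear_combination hx - hx' - hy + hy'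
  have hne : (lineLeft n i - lineLeft n j) - (lineRight i - lineRight j) ≠ 0 := by
    intro h0
    rw [← sub_eq_zero.1 h0] at h
    exact (mul_self_nonneg _).not_gt h
  have h1 : x 0 = y 0 := sub_eq_zero.1 ((mul_eq_zero.1 h0).resolve_right hne)
  ext m
  fin_cases m
  · exact h1
  · change x 1 = y 1
    rw [hx, hy, h1]

theorem pancakeLine_inter_inter {n : ℕ} {i j m : Fin n} (hij : i ≠ j) (him : i ≠ m)
    (hjm : j ≠ m) : pancakeLine n i ∩ pancakeLine n j ∩ pancakeLine n m = ∅ := by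
  rw [eq_empty_iff_forall_notMem]
  rintro z ⟨⟨h1, h2⟩, h3⟩
  exact not_concurrent (line_det_ne n (fun h => hij (Fin.ext h)) (fun h => him (Fin.ext h))
    fun h => hjm (Fin.ext h)) h1 h2 h3

theorem isPancakeGraph_pancakeLine (n : ℕ) : IsPancakeGraph (pancakeLine n) := by
  refine ⟨⟨fun i => !₂[0, lineLeft n i], fun i => !₂[1, lineRight i - lineLeft n i], fun i =>
    ⟨fun h => ?_, ?_⟩⟩, fun i j hij => ?_, fun i j m => pancakeLine_inter_inter⟩
  · simpa using congrFun (congrArg (fun z : Plane => (z : Fin 2 → ℝ)) h) 0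
  · ext z
    exact mem_line_iff.symm
  · obtain ⟨p, hp, hp'⟩ := exists_mem_hatpinRay hij
    exact ⟨p, (pancakeLine_inter_subsingleton hij).eq_singleton_of_mem
      ⟨hatpinRay_subset _ _ hp, hatpinRay_subset _ _ hp'⟩⟩

theorem isHatpinGraph_hatpinRay (n : ℕ) : IsHatpinGraph (hatpinRay n) := by
  refine ⟨⟨fun i => !₂[1, lineRight i], fun i => !₂[-1, lineLeft n i - lineRight i],
    fun i => ⟨fun h => ?_, ?_⟩, fun i j hij h => ?_⟩, fun i j hij => ?_,
    fun i j m h h' h'' => ?_⟩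
  · simpa using congrFun (congrArg (fun z : Plane => (z : Fin 2 → ℝ)) h) 0
  · ext z
    exact mem_ray_iff.symm
  -- A head on another ray would mean equal heights at abscissa 1, contrary to `line_mul_neg`.
  · have h1 := h.2
    have h2 := line_mul_neg n (i := i) (j := j) fun h => hij (Fin.ext h)
    simp at h1
    rw [h1] at h2
    simp at h2
  · obtain ⟨p, hp, hp'⟩ := exists_mem_hatpinRay hij
    exact ⟨p, ((pancakeLine_inter_subsingleton hij).anti
      (inter_subset_inter (hatpinRay_subset _ _) (hatpinRay_subset _ _))).eq_singleton_of_mem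
      ⟨hp, hp'⟩⟩
  · exact subset_empty_iff.1 ((inter_subset_inter (inter_subset_inter (hatpinRay_subset _ _)
      (hatpinRay_subset _ _)) (hatpinRay_subset _ _)).trans
        (pancakeLine_inter_inter h h' h'').subset)

/-! ### Distance to the lines, and directions of the infinite arms -/

section Narrow

variable {k n : ℕ} {δ : ℝ} {i : Fin n}

/-- The vertical gap to the line is δ times an affine function of the abscissa whose values at 0 and
1 are model heights, bounded by `4 ^ k`. For rays, `hℓ` asks that the point vertically above or
below be on the ray. -/
theorem infDist_le_of_mem_narrowChain (hδ : 0 ≤ δ) {z : Plane}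
    (hz : z ∈ (narrowChain k n δ i).carrier) {ℓ : Set Plane}
    (hℓ : !₂[z 0, (1 - z 0) * lineLeft n i + z 0 * lineRight i] ∈ ℓ) :
    Metric.infDist z ℓ ≤ 2 * δ * 4 ^ k * (1 + ‖z‖) := by
  obtain ⟨a, ha⟩ := mem_iUnion.1 hz
  have h1 := eq_of_mem_zigzag_arm (zigzagHeights_narrow n δ i) ha
  have hl : |modelLeft a| ≤ 4 ^ k := by
    unfold modelLeft
    rw [abs_of_nonneg (by positivity)]
    have h1 : ((a : ℕ) + 1) / 2 ≤ k := by have := a.2; omega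
    have h2 : k < 4 ^ k := Nat.lt_pow_self (by norm_num)
    exact_mod_cast h1.trans h2.le
  have hr : |modelRight a| ≤ 4 ^ k := by
    unfold modelRight
    rw [abs_neg, abs_of_nonneg (by positivity)]
    exact pow_le_pow_right₀ (by norm_num) (by have := a.2; omega)
  have hz0 : |z 0| ≤ ‖z‖ := by
    simpa using PiLp.norm_apply_le z 0
  refine (Metric.infDist_le_dist_of_mem hℓ).trans ?_
  have e : dist z !₂[z 0, (1 - z 0) * lineLeft n i + z 0 * lineRight i] =
      |δ * ((1 - z 0) * modelLeft a + z 0 * modelRight a)| := by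
    rw [EuclideanSpace.dist_eq, Fin.sum_univ_two]
    simp only [Real.dist_eq, sq_abs]
    rw [← Real.sqrt_sq_eq_abs]
    congr 1
    simp [h1, narrowLeft, narrowRight]
    ring
  rw [e, abs_mul, abs_of_nonneg hδ]
  have h2 : |1 - z 0| ≤ 1 + ‖z‖ := (abs_sub _ _).trans (by simpa using hz0)
  have h3 : |(1 - z 0) * modelLeft a + z 0 * modelRight a| ≤ 2 * 4 ^ k * (1 + ‖z‖) := by
    refine (abs_add_le _ _).trans ?_
    rw [abs_mul, abs_mul]
    have h4 : |1 - z 0| * |modelLeft a| ≤ (1 + ‖z‖) * 4 ^ k :=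
      mul_le_mul h2 hl (abs_nonneg _) (by positivity)
    have h5 : |z 0| * |modelRight a| ≤ (1 + ‖z‖) * 4 ^ k :=
      mul_le_mul (hz0.trans (by linarith)) hr (abs_nonneg _) (by positivity)
    linarith
  calc _ ≤ δ * (2 * 4 ^ k * (1 + ‖z‖)) := mul_le_mul_of_nonneg_left h3 hδ
    _ = _ := by ring

theorem narrowAround_pancakeLine (hδ : 0 ≤ δ) {ε : ℝ} (hε : 2 * δ * 4 ^ k ≤ ε) :
    (narrowChain k n δ i).NarrowAround ε (pancakeLine n i) := fun z hz =>
  (infDist_le_of_mem_narrowChain hδ hz (by simp [pancakeLine])).trans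
    (mul_le_mul_of_nonneg_right hε (by positivity))

theorem narrowAround_hatpinRay (hk : Even k) (hδ : 0 ≤ δ) {ε : ℝ} (hε : 2 * δ * 4 ^ k ≤ ε) :
    (narrowChain k n δ i).NarrowAround ε (hatpinRay n i) := fun z hz => by
  obtain ⟨a, ha⟩ := mem_iUnion.1 hz
  have h0 := le_one_of_mem_zigzag_arm (zigzagHeights_narrow n δ i) hk ha
  exact (infDist_le_of_mem_narrowChain (ℓ := hatpinRay n i) hδ hz ⟨by simpa using h0, by simp⟩).trans
    (mul_le_mul_of_nonneg_right hε (by positivity))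

theorem inner_plane (x y : Plane) : inner ℝ x y = x 0 * y 0 + x 1 * y 1 := by
  rw [PiLp.inner_apply, Fin.sum_univ_two]
  simp
  ring

/-- For odd `k` the last arm has even index, so like the first it is traversed from left to right.
-/
theorem endsOpposite_narrowChain (hk : Odd k)
    (h : ∀ a b : Fin k, -((narrowLeft n δ i a - narrowRight δ i a) *
      (narrowLeft n δ i b - narrowRight δ i b)) - 1 < 0) :
    (narrowChain k n δ i).EndsOpposite := by
  intro a b ha hb
  have ha' : Even (a : ℕ) := by simp [ha]
  have hb' : Even (b : ℕ) := by
    rw [← hb] at hk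
    simpa [Nat.odd_add_one] using hk
  rw [narrowChain, zigzag_dir_even (zigzagHeights_narrow n δ i) ha',
    zigzag_dir_even (zigzagHeights_narrow n δ i) hb', inner_plane]
  simp
  linarith [h a b]

theorem endsParallel_narrowChain (hk : Even k)
    (h : ∀ a b : Fin k, -((narrowLeft n δ i a - narrowRight δ i a) *
      (narrowLeft n δ i b - narrowRight δ i b)) - 1 < 0) :
    (narrowChain k n δ i).EndsParallel := by
  intro a b ha hb
  have ha' : Even (a : ℕ) := by simp [ha]
  have hb' : ¬Even (b : ℕ) := by
    rw [← hb] at hk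
    simpa [Nat.even_add_one] using hk
  rw [narrowChain, zigzag_dir_even (zigzagHeights_narrow n δ i) ha',
    zigzag_dir_odd (zigzagHeights_narrow n δ i) hb', inner_plane]
  simp
  linarith [h a b]

end Narrow

theorem chainRegionCount_eq {k n : ℕ} (hk : 1 ≤ k) {C : Fin n → Chain k}
    (hC : InGeneralPosition C) (hcross : ∀ y : ArmPair n k,
      ((C y.1.1.1).openArm y.1.1.2 ∩ (C y.1.2.1).openArm y.1.2.2).Nonempty) :
    chainRegionCount C = maxRegions k n :=
  le_antisymm (chainRegionCount_le hk C) (hC.maxRegions_le hk hcross)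

theorem eventually_narrow (k : ℕ) {ε : ℝ} (hε : 0 < ε) :
    ∀ᶠ δ : ℝ in 𝓝[>] 0, 0 ≤ δ ∧ 2 * δ * 4 ^ k ≤ ε := by
  have h := eventually_neg_of_continuous (f := fun δ : ℝ => 2 * δ * 4 ^ k - ε) (by fun_prop)
    (by simpa using hε)
  filter_upwards [h, self_mem_nhdsWithin] with δ h1 h2
  exact ⟨le_of_lt h2, by linarith⟩

end

theorem mainTheorem3 (k n : ℕ) (hk : 1 ≤ k) :
    -- the maximum number of self-crossings of a single chain
    IsGreatest (Set.range fun C : Chain k => C.selfCrossings.encard) (((k - 1).choose 2 : ℕ) : ℕ∞) ∧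
    -- the maximum number of intersections of two chains
    IsGreatest (Set.range fun CD : Chain k × Chain k => (CD.1.intersections CD.2).encard)
      ((k ^ 2 : ℕ) : ℕ∞) ∧
    -- the maximum number of regions
    ∃ a : ℕ,
      (a : ℝ) = (k : ℝ) ^ 2 * (n : ℝ) ^ 2 / 2 - 3 * (k : ℝ) * (n : ℝ) / 2 + 2 * (n : ℝ) + 1 ∧
      IsGreatest (Set.range fun C : Fin n → Chain k => chainRegionCount C) (a : ℕ∞) ∧
      -- attained by arbitrarily narrow chains substituted into a pancake graph
      (Odd k → ∃ L : Fin n → Set Plane, IsPancakeGraph L ∧ ∀ ε : ℝ, 0 < ε →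
        ∃ C : Fin n → Chain k,
          (∀ i, (C i).NarrowAround ε (L i) ∧ (C i).EndsOpposite ∧
            (C i).selfCrossings.encard = (((k - 1).choose 2 : ℕ) : ℕ∞)) ∧
          (∀ i j, i ≠ j → ((C i).intersections (C j)).encard = ((k ^ 2 : ℕ) : ℕ∞)) ∧
          chainRegionCount C = (a : ℕ∞)) ∧
      -- attained by arbitrarily narrow chains substituted into a hatpin graph
      (Even k → ∃ L : Fin n → Set Plane, IsHatpinGraph L ∧ ∀ ε : ℝ, 0 < ε →
        ∃ C : Fin n → Chain k,
          (∀ i, (C i).NarrowAround ε (L i) ∧ (C i).EndsParallel ∧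
            (C i).selfCrossings.encard = (((k - 1).choose 2 : ℕ) : ℕ∞)) ∧
          (∀ i j, i ≠ j → ((C i).intersections (C j)).encard = ((k ^ 2 : ℕ) : ℕ∞)) ∧
          chainRegionCount C = (a : ℕ∞)) := by
  refine ⟨⟨?_, ?_⟩, ⟨?_, ?_⟩, maxRegions k n, cast_maxRegions hk n, ⟨?_, ?_⟩,
    fun hodd => ⟨pancakeLine n, isPancakeGraph_pancakeLine n, fun ε hε => ?_⟩,
    fun heven => ⟨hatpinRay n, isHatpinGraph_hatpinRay n, fun ε hε => ?_⟩⟩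
  · obtain ⟨δ, hC, hcross, -⟩ := (eventually_narrowChain k 1).exists
    exact ⟨narrowChain k 1 δ 0, hC.encard_selfCrossings hcross 0⟩
  · rintro _ ⟨C, rfl⟩
    exact C.encard_selfCrossings_le
  · obtain ⟨δ, hC, hcross, -⟩ := (eventually_narrowChain k 2).exists
    exact ⟨(narrowChain k 2 δ 0, narrowChain k 2 δ 1), hC.encard_intersections hcross zero_ne_one⟩
  · rintro _ ⟨C, rfl⟩
    exact C.1.encard_intersections_le C.2
  · obtain ⟨δ, hC, hcross, -⟩ := (eventually_narrowChain k n).exists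
    exact ⟨narrowChain k n δ, chainRegionCount_eq hk hC hcross⟩
  · rintro _ ⟨C, rfl⟩
    exact chainRegionCount_le hk C
  · obtain ⟨δ, ⟨hC, hcross, hends⟩, hδ, hδε⟩ :=
      ((eventually_narrowChain k n).and (eventually_narrow k hε)).exists
    exact ⟨narrowChain k n δ, fun i => ⟨narrowAround_pancakeLine hδ hδε,
      endsOpposite_narrowChain hodd (hends i), hC.encard_selfCrossings hcross i⟩,
      fun i j hij => hC.encard_intersections hcross hij, chainRegionCount_eq hk hC hcross⟩
  · obtain ⟨δ, ⟨hC, hcross, hends⟩, hδ, hδε⟩ :=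
      ((eventually_narrowChain k n).and (eventually_narrow k hε)).exists
    exact ⟨narrowChain k n δ, fun i => ⟨narrowAround_hatpinRay heven hδ hδε,
      endsParallel_narrowChain heven (hends i), hC.encard_selfCrossings hcross i⟩,
      fun i j hij => hC.encard_intersections hcross hij, chainRegionCount_eq hk hC hcross⟩
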